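/- Theorem 1.6. All digraphs are finite, without loops and multiple arcs (a pair of opposite arcs is allowed). A bipartite digraph is balanced if its two partite sets have the same number of vertices; a digraph is strong if for every two distinct vertices $x,y$ there is a directed path from $x$ to $y$ and one from $y$ to $x$. A Hamiltonian bypass in a digraph is a directed path $x_1x_2\cdots x_m$ through all vertices, each visited exactly once ($m\ge 2$), such that $x_1x_m$ is also an arc. (i) Let $B$ be a strong balanced bipartite digraph of order $2a \ge 6$. Suppose that $d^+(u)+d^-(v)\ge a+1$ for all vertices $u$ and $v$ from different partite sets such that $uv$ is not an arc of $B$. Then $B$ contains a Hamiltonian bypass. (ii) The bound $a+1$ is sharp, in the sense that it cannot be lowered to $a$: there is a strong (even Hamiltonian) balanced bipartite digraph of order $8$ (so $a=4$) such that $d^+(u)+d^-(v)\ge a$ for all vertices $u$ and $v$ from different partite sets for which $uv$ is not an arc, but which contains no Hamiltonian bypass. -/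

import Mathlib

namespace Digraph

variable {V : Type*}

/-- `l = [x, …, y]` is a (directed, simple) path of `D` from `x` to `y`: its vertices are pairwise
distinct, consecutive vertices are joined by arcs, it starts in `x` and it ends in `y`. -/
def IsDiPath (D : Digraph V) (x y : V) (l : List V) : Prop :=
  l.Nodup ∧ l.IsChain D.Adj ∧ l.head? = some x ∧ l.getLast? = some y

/-- `D` is strong (strongly connected): for all distinct `x`, `y` there is a path from `x` to `y`
(and, exchanging their roles, one from `y` to `x`). -/
def IsStrong (D : Digraph V) : Prop :=
  ∀ x y : V, x ≠ y → ∃ l : List V, D.IsDiPath x y l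

/-- `X` and `Y` are the partite sets of the balanced bipartite digraph `D`: they partition the
vertex set, have the same size, and every arc joins vertices of different sets (so `D` has no
loops). -/
structure IsBalancedBipartition (D : Digraph V) (X Y : Set V) : Prop where
  isCompl : IsCompl X Y
  balanced : X.ncard = Y.ncard
  arc : ∀ u v : V, D.Adj u v → (u ∈ X ∧ v ∈ Y) ∨ (u ∈ Y ∧ v ∈ X)

/-- The out-degree of `u` (the vertex set is finite wherever this is used). -/
noncomputable def outDeg (D : Digraph V) (u : V) : ℕ := {w : V | D.Adj u w}.ncard

/-- The in-degree of `v` (the vertex set is finite wherever this is used). -/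
noncomputable def inDeg (D : Digraph V) (v : V) : ℕ := {w : V | D.Adj w v}.ncard

/-- `d⁺(u) + d⁻(v) ≥ m` for all `u`, `v` in different sets among `X`, `Y` such that `uv` is not
an arc. -/
def DegreeSumGE (D : Digraph V) (X Y : Set V) (m : ℕ) : Prop :=
  ∀ u v : V, ((u ∈ X ∧ v ∈ Y) ∨ (u ∈ Y ∧ v ∈ X)) → ¬ D.Adj u v → m ≤ D.outDeg u + D.inDeg v

/-- `D` contains a Hamiltonian bypass: a path `x₁ x₂ ⋯ xₘ` with `m ≥ 2` through all vertices such
that `x₁ xₘ` is an arc. -/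
def HasHamiltonianBypass (D : Digraph V) : Prop :=
  ∃ (x y : V) (l : List V), D.IsDiPath x y l ∧ 2 ≤ l.length ∧ (∀ v : V, v ∈ l) ∧ D.Adj x y

/-- `D` is Hamiltonian: it has a cycle `x₁ x₂ ⋯ xₘ x₁` with `m ≥ 2` through all vertices,
that is, a path `x₁ x₂ ⋯ xₘ` through all vertices such that `xₘ x₁` is an arc. -/
def IsHamiltonianDigraph (D : Digraph V) : Prop :=
  ∃ (x y : V) (l : List V), D.IsDiPath x y l ∧ 2 ≤ l.length ∧ (∀ v : V, v ∈ l) ∧ D.Adj y x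

end Digraph

/-!
The arcs from `X` to `Y` and those from `Y` to `X` are two bipartite graphs, and the degree
condition is a condition on each of them alone. By Hall's theorem, the second one contains a perfect
matching `y i → x i` (`exists_matched`). Contracting it gives the relation `H i j`, that is,
`x i → y j`, on `a` indices, with `d⁺(i) + d⁻(j) ≥ a + 1` whenever `H i j` fails; here loops count,
and `i = j` is allowed. A Hamilton cycle of `H` is a Hamilton cycle of the digraph through the
matching.

If `H` has a Hamilton cycle, then a loop `H i i` is an arc `x i → y i` opposite to an arc of the
cycle, which is a bypass. Without loops, the degree condition is strong enough for `H` to have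
Hamilton paths with any prescribed ends `p ≠ q` (`exists_hamilton_path`), and choosing the ends such
that `y p → x q` gives a bypass.

If `H` has no Hamilton cycle, then an argument in the manner of Meyniel's theorem (a longest cycle,
and the shortest piece of it that can be cut out in favour of outside vertices) shows that `H` just
meets the degree condition: the indices split into a path `W` and two complete parts `I` and `P`
without arcs in between, both of which close up `W` to a cycle (`exists_blocks`). Every arc from
some `y i` with `i ∈ I` to some `x t` with `t ∈ P` is the chord of a bypass, and so are certain
arcs between these vertices and those of `W`. Without a bypass, the arcs that remain are too few for
the degree condition on the arcs from `Y` to `X` (`Matched.exists_hamilton_cycle`).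

The digraph that shows sharpness is the directed cycle of length four with all vertices doubled.
-/

namespace HamBypass

variable {α : Type*} {r : α → α → Prop}

/-! ### Paths and cycles of a relation, as lists -/

/-- The last entry of `l₁` is related to the first entry of `l₂` (no condition if one of the two
lists is empty). -/
def Link (r : α → α → Prop) (l₁ l₂ : List α) : Prop :=
  ∀ x ∈ l₁.getLast?, ∀ y ∈ l₂.head?, r x y

/-- A path of the relation `r`; the empty list is allowed. -/
structure IsPath (r : α → α → Prop) (l : List α) : Prop where
  nodup : l.Nodup
  chain : l.IsChain r

/-- A cycle of the relation `r`, cut open at some vertex. A vertex `x` with `r x x` is a cycle of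
length one, and the empty list is allowed. -/
structure IsCycle (r : α → α → Prop) (l : List α) : Prop extends IsPath r l where
  link : Link r l l

theorem link_append_left {l₁ l₂ l₃ : List α} (h : l₂ ≠ []) :
    Link r (l₁ ++ l₂) l₃ ↔ Link r l₂ l₃ := by
  simp only [Link, List.getLast?_append_of_ne_nil l₁ h]

theorem link_append_right {l₁ l₂ l₃ : List α} (h : l₂ ≠ []) :
    Link r l₁ (l₂ ++ l₃) ↔ Link r l₁ l₂ := by
  simp only [Link, List.head?_append_of_ne_nil l₂ h]

@[simp] theorem link_concat_left {l₁ l₃ : List α} {x : α} :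
    Link r (l₁ ++ [x]) l₃ ↔ ∀ y ∈ l₃.head?, r x y := by
  simp [Link]

theorem isPath_append {l₁ l₂ : List α} :
    IsPath r (l₁ ++ l₂) ↔ IsPath r l₁ ∧ IsPath r l₂ ∧ l₁.Disjoint l₂ ∧ Link r l₁ l₂ := by
  constructor
  · rintro ⟨h, h'⟩
    rw [List.nodup_append'] at h
    rw [List.isChain_append] at h'
    exact ⟨⟨h.1, h'.1⟩, ⟨h.2.1, h'.2.1⟩, h.2.2, h'.2.2⟩
  · rintro ⟨h₁, h₂, h, h'⟩
    exact ⟨List.nodup_append'.2 ⟨h₁.1, h₂.1, h⟩, List.isChain_append.2 ⟨h₁.2, h₂.2, h'⟩⟩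

theorem isCycle_append {l₁ l₂ : List α} (h₁ : l₁ ≠ []) (h₂ : l₂ ≠ []) :
    IsCycle r (l₁ ++ l₂) ↔
      IsPath r l₁ ∧ IsPath r l₂ ∧ l₁.Disjoint l₂ ∧ Link r l₁ l₂ ∧ Link r l₂ l₁ := by
  constructor
  · rintro ⟨h, h'⟩
    rw [link_append_left h₂, link_append_right h₁] at h'
    rw [isPath_append] at h
    exact ⟨h.1, h.2.1, h.2.2.1, h.2.2.2, h'⟩
  · rintro ⟨a, b, c, d, e⟩
    refine ⟨isPath_append.2 ⟨a, b, c, d⟩, ?_⟩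
    rwa [link_append_left h₂, link_append_right h₁]

theorem IsCycle.rotate {l₁ l₂ : List α} (h : IsCycle r (l₁ ++ l₂)) : IsCycle r (l₂ ++ l₁) := by
  rcases eq_or_ne l₁ [] with rfl | h₁
  · simpa using h
  rcases eq_or_ne l₂ [] with rfl | h₂
  · simpa using h
  rw [isCycle_append h₁ h₂] at h
  rw [isCycle_append h₂ h₁]
  exact ⟨h.2.1, h.1, h.2.2.1.symm, h.2.2.2.2, h.2.2.2.1⟩

/-- A cycle can be cut open before any of its vertices. -/
theorem IsCycle.exists_cons {l : List α} (h : IsCycle r l) {x : α} (hx : x ∈ l) :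
    ∃ l', IsCycle r (x :: l') ∧ (x :: l').Perm l := by
  obtain ⟨l₁, l₂, rfl⟩ := List.append_of_mem hx
  exact ⟨l₂ ++ l₁, by simpa using h.rotate, by simpa using List.perm_append_comm (l₁ := x :: l₂)⟩

/-- A cycle can be cut open after any of its vertices. -/
theorem IsCycle.exists_concat {l : List α} (h : IsCycle r l) {x : α} (hx : x ∈ l) :
    ∃ l', IsCycle r (l' ++ [x]) ∧ (l' ++ [x]).Perm l := by
  obtain ⟨l₁, l₂, rfl⟩ := List.append_of_mem hx
  have e : l₁ ++ x :: l₂ = (l₁ ++ [x]) ++ l₂ := by simp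
  refine ⟨l₂ ++ l₁, ?_, ?_⟩
  · rw [e] at h
    simpa using h.rotate
  · rw [e]
    simpa using List.perm_append_comm (l₁ := l₂) (l₂ := l₁ ++ [x])

/-- In a cycle, any two vertices are joined by a path. -/
theorem IsCycle.exists_path {l : List α} (h : IsCycle r l) {x y : α} (hx : x ∈ l) (hy : y ∈ l) :
    ∃ q, IsPath r q ∧ (∀ v ∈ q, v ∈ l) ∧ q.head? = some x ∧ q.getLast? = some y := by
  obtain ⟨l', h', hp⟩ := h.exists_cons hx
  have hy' := hp.mem_iff.2 hy
  obtain ⟨q₁, q₂, hq⟩ := List.append_of_mem hy'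
  have e : x :: l' = (q₁ ++ [y]) ++ q₂ := by simp [hq]
  refine ⟨q₁ ++ [y], ?_, fun v hv => hp.mem_iff.1 ?_, ?_, by simp⟩
  · have := h'.toIsPath
    rw [e] at this
    exact (isPath_append.1 this).1
  · rw [e]
    exact List.mem_append_left _ hv
  · have := congrArg List.head? e
    rw [List.head?_append_of_ne_nil _ (by simp)] at this
    simpa using this.symm

/-- Two disjoint paths, each leading on to the other, close up to a cycle. -/
theorem isCycle_of_paths {W Q : List α} (hW : IsPath r W) (hQ : IsPath r Q) (hW' : W ≠ [])
    (hQ' : Q ≠ []) (hd : W.Disjoint Q) (h₁ : Link r W Q) (h₂ : Link r Q W) :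
    IsCycle r (W ++ Q) :=
  (isCycle_append hW' hQ').2 ⟨hW, hQ, hd, h₁, h₂⟩

/-- A path `Q` can be inserted between two consecutive vertices of a path. -/
theorem IsPath.insert {l₁ l₂ Q : List α} {u v : α} (h : IsPath r (l₁ ++ u :: v :: l₂))
    (hQ : IsPath r Q) (hQ' : Q ≠ []) (hd : (l₁ ++ u :: v :: l₂).Disjoint Q)
    (h₁ : ∀ s ∈ Q.head?, r u s) (h₂ : ∀ t ∈ Q.getLast?, r t v) :
    IsPath r ((l₁ ++ [u]) ++ (Q ++ v :: l₂)) := by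
  have e : l₁ ++ u :: v :: l₂ = (l₁ ++ [u]) ++ v :: l₂ := by simp
  rw [e] at h hd
  rw [isPath_append] at h
  rw [List.disjoint_append_left] at hd
  refine isPath_append.2 ⟨h.1, isPath_append.2 ⟨hQ, h.2.1, hd.2.symm, ?_⟩, ?_, ?_⟩
  · simpa [Link] using h₂
  · exact List.disjoint_append_right.2 ⟨hd.1, h.2.2.1⟩
  · rw [link_append_right hQ']
    simpa using h₁

/-! ### Counting -/

open Classical in
/-- The number of entries of `l` that satisfy `p`. -/
noncomputable def cnt (p : α → Prop) (l : List α) : ℕ := l.countP (fun x => decide (p x))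

@[simp] theorem cnt_nil (p : α → Prop) : cnt p [] = 0 := by simp [cnt]

open Classical in
theorem cnt_cons (p : α → Prop) (x : α) (l : List α) :
    cnt p (x :: l) = cnt p l + if p x then 1 else 0 := by
  simp [cnt, List.countP_cons]

@[simp] theorem cnt_append (p : α → Prop) (l₁ l₂ : List α) :
    cnt p (l₁ ++ l₂) = cnt p l₁ + cnt p l₂ := by simp [cnt]

theorem cnt_le_length (p : α → Prop) (l : List α) : cnt p l ≤ l.length := List.countP_le_length

theorem cnt_eq_zero {p : α → Prop} {l : List α} (h : ∀ x ∈ l, ¬ p x) : cnt p l = 0 := by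
  simpa [cnt] using h

theorem exists_of_cnt_pos {p : α → Prop} {l : List α} (h : 0 < cnt p l) : ∃ x ∈ l, p x := by
  simpa [cnt] using h

theorem cnt_lt_length {p : α → Prop} {l : List α} {x : α} (hx : x ∈ l) (h : ¬ p x) :
    cnt p l + 1 ≤ l.length := by
  rw [Nat.succ_le_iff, cnt]
  refine lt_of_le_of_ne List.countP_le_length fun he => h ?_
  simpa using List.countP_eq_length.1 he x hx

theorem cnt_perm {p : α → Prop} {l₁ l₂ : List α} (h : l₁.Perm l₂) : cnt p l₁ = cnt p l₂ :=
  h.countP_eq _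

theorem ncard_eq_cnt {l : List α} (hl : l.Nodup) (hall : ∀ x, x ∈ l) (p : α → Prop) :
    {x | p x}.ncard = cnt p l := by
  classical
  have : {x | p x} = ((l.filter (fun x => decide (p x))).toFinset : Set α) := by
    ext x
    simp [hall x]
  rw [this, Set.ncard_coe_finset, List.toFinset_card_of_nodup (hl.filter _), cnt,
    List.countP_eq_length_filter]

open Classical in
/-- If no vertex can be inserted between consecutive entries of `W`, where `p w` stands for an arc
from `w` and `q w` for an arc to `w`, then there are at most `|W| - 1` arcs besides the one to the
first and the one from the last entry. -/
theorem cnt_add_cnt_succ_le {p q : α → Prop} {W : List α} {b e : α}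
    (h : W.IsChain (fun u v => ¬ (p u ∧ q v))) (hb : W.head? = some b) (he : W.getLast? = some e) :
    cnt p W + cnt q W + 1 ≤ W.length + (if q b then 1 else 0) + (if p e then 1 else 0) := by
  induction W generalizing b with
  | nil => simp at hb
  | cons w W ih =>
    obtain rfl : w = b := by simpa using hb
    cases W with
    | nil =>
      obtain rfl : w = e := by simpa using he
      simp only [cnt_cons, cnt_nil, List.length_cons, List.length_nil]
      omega
    | cons v W =>
      rw [List.isChain_cons_cons] at h
      have := ih h.2 rfl (by simpa using he)
      have h1 : (if p w then 1 else 0) + (if q v then 1 else 0) ≤ 1 := by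
        have := h.1
        split_ifs <;> simp_all
      rw [cnt_cons p w, cnt_cons q w, List.length_cons]
      omega

theorem cnt_add_cnt_le {p q : α → Prop} {W : List α}
    (h : W.IsChain (fun u v => ¬ (p u ∧ q v))) : cnt p W + cnt q W ≤ W.length + 1 := by
  classical
  rcases W.eq_nil_or_concat with rfl | ⟨W', e, rfl⟩
  · simp
  · rw [List.concat_eq_append] at h ⊢
    obtain ⟨b, hb⟩ : ∃ b, (W' ++ [e]).head? = some b := by cases W' <;> simp
    have h2 := cnt_add_cnt_succ_le h hb (e := e) (by simp)
    split_ifs at h2 <;> omega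

/-- If the path `Q` cannot be inserted between consecutive vertices of `W`, then the arcs from `W`
to the head of `Q` and those from the last vertex of `Q` to `W` avoid consecutive pairs. -/
theorem isChain_of_not_insert {W Q : List α} {s t : α} (hW : IsPath r W) (hQ : IsPath r Q)
    (hs : Q.head? = some s) (ht : Q.getLast? = some t) (hd : W.Disjoint Q)
    (hmax : ∀ W', IsPath r W' → W'.head? = W.head? → W'.getLast? = W.getLast? →
      W'.Perm (W ++ Q) → False) :
    W.IsChain (fun u v => ¬ (r u s ∧ r t v)) := by
  rw [List.isChain_iff_forall_rel_of_append_cons_cons]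
  rintro u v l₁ l₂ rfl ⟨h₁, h₂⟩
  have hQ' : Q ≠ [] := by rintro rfl; simp at hs
  refine hmax _ (hW.insert hQ hQ' hd (by simpa [hs] using h₁) (by simpa [ht] using h₂)) ?_ ?_ ?_
  · cases l₁ <;> simp
  · rw [List.getLast?_append_of_ne_nil _ (by simp), List.getLast?_append_of_ne_nil _ (by simp),
      List.getLast?_append_of_ne_nil l₁ (by simp), List.getLast?_cons_cons]
  · have : ((l₁ ++ [u]) ++ (Q ++ v :: l₂)).Perm ((l₁ ++ [u]) ++ (v :: l₂ ++ Q)) :=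
      List.Perm.append_left _ List.perm_append_comm
    simpa using this

/-- A cycle that has a vertex with `p` and a vertex with `q` splits into a path `W` from a `q` to a
`p`, and a path `I` whose vertices have neither: choose `I` as short as possible. -/
theorem IsCycle.exists_gap {C : List α} (hC : IsCycle r C) {p q : α → Prop}
    (hp : ∃ c ∈ C, p c) (hq : ∃ c ∈ C, q c) :
    ∃ W I : List α, IsCycle r (W ++ I) ∧ (W ++ I).Perm C ∧
      (∃ b, W.head? = some b ∧ q b) ∧ (∃ e, W.getLast? = some e ∧ p e) ∧
      ∀ c ∈ I, ¬ p c ∧ ¬ q c := by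
  obtain ⟨a, ha, hpa⟩ := hp
  obtain ⟨b, hb, hqb⟩ := hq
  obtain ⟨l, hl, hlC⟩ := hC.exists_concat ha
  obtain ⟨m₁, m₂, hm⟩ := List.append_of_mem (hlC.mem_iff.2 hb)
  have key : ∀ n : ℕ, ∀ W I : List α, I.length = n → IsCycle r (W ++ I) → (W ++ I).Perm C →
      (∃ b, W.head? = some b ∧ q b) → (∃ e, W.getLast? = some e ∧ p e) →
      ∃ W I : List α, IsCycle r (W ++ I) ∧ (W ++ I).Perm C ∧
      (∃ b, W.head? = some b ∧ q b) ∧ (∃ e, W.getLast? = some e ∧ p e) ∧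
      ∀ c ∈ I, ¬ p c ∧ ¬ q c := by
    intro n
    induction n using Nat.strong_induction_on with
    | _ n ih =>
      intro W I hn hc hperm hb he
      by_cases hI : ∀ c ∈ I, ¬ p c ∧ ¬ q c
      · exact ⟨W, I, hc, hperm, hb, he, hI⟩
      have hW : W ≠ [] := by rintro rfl; simp at hb
      push Not at hI
      obtain ⟨c, hcI, hpq⟩ := hI
      obtain ⟨i₁, i₂, rfl⟩ := List.append_of_mem hcI
      by_cases hpc : p c
      · refine ih i₂.length ?_ (W ++ (i₁ ++ [c])) i₂ rfl (by simpa using hc) (by simpa using hperm)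
          ?_ ⟨c, by simp, hpc⟩
        · simp at hn; omega
        · rwa [List.head?_append_of_ne_nil _ hW]
      · have e : W ++ (i₁ ++ c :: i₂) = (W ++ i₁) ++ c :: i₂ := by simp
        rw [e] at hc hperm
        refine ih i₁.length ?_ (c :: i₂ ++ W) i₁ rfl ?_ ?_ ⟨c, by simp, hpq hpc⟩ ?_
        · simp at hn; omega
        · simpa using hc.rotate
        · refine List.Perm.trans ?_ hperm
          simpa using List.perm_append_comm (l₁ := c :: i₂) (l₂ := W ++ i₁)
        · rwa [List.getLast?_append_of_ne_nil _ hW]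
  refine key _ (b :: m₂) m₁ rfl ?_ ?_ ⟨b, by simp, hqb⟩ ?_
  · rw [hm] at hl; exact hl.rotate
  · rw [hm] at hlC; exact List.perm_append_comm.trans hlC
  · refine ⟨a, ?_, hpa⟩
    have := congrArg List.getLast? hm
    rw [List.getLast?_append_of_ne_nil m₁ (by simp)] at this
    rw [← this]; simp

/-! ### A degree sum condition on a relation -/

/-- The out-degree of `i` in the relation `r`; a loop at `i` counts. -/
noncomputable def outN (r : α → α → Prop) (i : α) : ℕ := {j | r i j}.ncard

/-- The in-degree of `j` in the relation `r`; a loop at `j` counts. -/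
noncomputable def inN (r : α → α → Prop) (j : α) : ℕ := {i | r i j}.ncard

/-- `d⁺(i) + d⁻(j) ≥ N` whenever `i` is not related to `j`; here `i = j` is allowed. -/
def DegSum (r : α → α → Prop) (N : ℕ) : Prop :=
  ∀ i j, ¬ r i j → N ≤ outN r i + inN r j

theorem outN_eq {l : List α} (hl : l.Nodup) (hall : ∀ x, x ∈ l) (i : α) :
    outN r i = cnt (r i) l := ncard_eq_cnt hl hall _

theorem inN_eq {l : List α} (hl : l.Nodup) (hall : ∀ x, x ∈ l) (j : α) :
    inN r j = cnt (fun i => r i j) l := ncard_eq_cnt hl hall _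

theorem card_eq_length {l : List α} (hl : l.Nodup) (hall : ∀ x, x ∈ l) :
    Nat.card α = l.length := by
  rw [← Set.ncard_univ]
  have := ncard_eq_cnt hl hall (fun _ => True)
  simpa [cnt] using this

theorem exists_longest {p : List α → Prop} (n : ℕ) (hb : ∀ l, p l → l.length ≤ n)
    (h : ∃ l, p l) : ∃ l, p l ∧ ∀ l', p l' → l'.length ≤ l.length := by
  let S : Set ℕ := {k | ∃ l, p l ∧ l.length = k}
  have hS : BddAbove S := ⟨n, by rintro _ ⟨l, hl, rfl⟩; exact hb l hl⟩
  obtain ⟨l, hl⟩ := h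
  obtain ⟨l', hl', he⟩ := Nat.sSup_mem (s := S) ⟨_, l, hl, rfl⟩ hS
  exact ⟨l', hl', fun l'' h'' => he ▸ le_csSup hS ⟨l'', h'', rfl⟩⟩

theorem IsCycle.replace_left {W W' I : List α} (h : IsCycle r (W ++ I)) (hW : W ≠ [])
    (h' : IsPath r W') (hd : W'.Disjoint I) (hh : W'.head? = W.head?)
    (hl : W'.getLast? = W.getLast?) : IsCycle r (W' ++ I) := by
  have hW' : W' ≠ [] := by
    rintro rfl
    simp at hh
    exact hW (by simpa using hh.symm)
  rcases eq_or_ne I [] with rfl | hI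
  · rw [List.append_nil] at h ⊢
    exact ⟨h', by have := h.link; simpa only [Link, hh, hl] using this⟩
  · rw [isCycle_append hW hI] at h
    rw [isCycle_append hW' hI]
    refine ⟨h', h.2.1, hd, ?_, ?_⟩
    · simpa only [Link, hl] using h.2.2.2.1
    · simpa only [Link, hh] using h.2.2.2.2

/-- Let `C` be a longest cycle and `P` a path from `s` to `t` outside `C`. The arcs from `C` to `s`
and those from `t` to `C`, if there are both, number at most `|C| - |P| + 1` together: `P` cannot
be inserted into `C`, and it cannot replace fewer than `|P|` vertices of `C` either. -/
theorem cnt_add_cnt_add_length_le {C P : List α} {s t : α} (hC : IsCycle r C)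
    (hmax : ∀ l, IsCycle r l → l.length ≤ C.length) (hP : IsPath r P) (hd : C.Disjoint P)
    (hs : P.head? = some s) (ht : P.getLast? = some t)
    (hA : ∃ c ∈ C, r c s) (hB : ∃ c ∈ C, r t c) :
    cnt (fun c => r c s) C + cnt (r t) C + P.length ≤ C.length + 1 := by
  obtain ⟨W, I, hWI, hperm, ⟨b, hb, hqb⟩, ⟨e, he, hpe⟩, hI⟩ :=
    hC.exists_gap (p := fun c => r c s) (q := r t) hA hB
  have hW : W ≠ [] := by rintro rfl; simp at hb
  have hP' : P ≠ [] := by rintro rfl; simp at hs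
  have hWp := (isPath_append.1 hWI.toIsPath).1
  have hWd : (W ++ I).Disjoint P := fun x hx => hd (hperm.mem_iff.1 hx)
  rw [List.disjoint_append_left] at hWd
  have hlen := hperm.length_eq
  rw [List.length_append] at hlen
  have h1 : (W ++ P).length ≤ C.length := by
    refine hmax _ (isCycle_of_paths hWp hP hW hP' hWd.1 ?_ ?_)
    · simpa [Link, he, hs] using hpe
    · simpa [Link, hb, ht] using hqb
  rw [List.length_append] at h1
  have hch := isChain_of_not_insert hWp hP hs ht hWd.1 (by
    intro W' hW' hh hl hp
    have := hmax _ (hWI.replace_left hW hW' (by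
      intro x hx hxI
      rcases List.mem_append.1 (hp.mem_iff.1 hx) with h | h
      · exact (isPath_append.1 hWI.toIsPath).2.2.1 h hxI
      · exact hWd.2 hxI h) hh hl)
    rw [List.length_append, hp.length_eq, List.length_append] at this
    have := List.length_pos_of_ne_nil hP'
    omega)
  have h2 := cnt_add_cnt_le hch
  rw [← cnt_perm hperm, ← cnt_perm hperm, cnt_append, cnt_append,
    cnt_eq_zero (fun c hc => (hI c hc).1), cnt_eq_zero (fun c hc => (hI c hc).2)]
  omega

/-- `C` is a longest cycle, `P` is a longest path outside `C`, from `s` to `t`, and `Q` lists the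
remaining vertices. -/
structure Config (r : α → α → Prop) (C P Q : List α) (s t : α) : Prop where
  cyc : IsCycle r C
  max : ∀ l, IsCycle r l → l.length ≤ C.length
  path : IsPath r P
  longest : ∀ P', IsPath r P' → C.Disjoint P' → P'.length ≤ P.length
  nodup : (C ++ P ++ Q).Nodup
  mem : ∀ v, v ∈ C ++ P ++ Q
  head : P.head? = some s
  last : P.getLast? = some t

namespace Config

variable {C P Q : List α} {s t : α}

theorem disj (h : Config r C P Q s t) : C.Disjoint P ∧ C.Disjoint Q ∧ P.Disjoint Q := by
  have := h.nodup
  rw [List.nodup_append', List.nodup_append', List.disjoint_append_left] at this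
  exact ⟨this.1.2.2, this.2.2.1, this.2.2.2⟩

theorem card_eq (h : Config r C P Q s t) :
    Nat.card α = C.length + P.length + Q.length := by
  simpa [add_assoc] using card_eq_length h.nodup h.mem

theorem ne_nil (h : Config r C P Q s t) : P ≠ [] := by
  rintro rfl
  simpa using h.head

theorem s_mem (h : Config r C P Q s t) : s ∈ P := List.mem_of_mem_head? h.head

theorem t_mem (h : Config r C P Q s t) : t ∈ P := List.mem_of_mem_getLast? h.last

theorem not_to_s (h : Config r C P Q s t) {w : α} (hw : w ∈ Q) : ¬ r w s := by
  intro hr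
  have h1 : IsPath r ([w] ++ P) := isPath_append.2 ⟨⟨by simp, by simp⟩, h.path,
    by simpa using fun hP => h.disj.2.2 hP hw, by simpa [Link, h.head] using hr⟩
  have := h.longest _ h1 (List.disjoint_append_right.2
    ⟨by simpa using fun hC => h.disj.2.1 hC hw, h.disj.1⟩)
  simp at this

theorem not_from_t (h : Config r C P Q s t) {w : α} (hw : w ∈ Q) : ¬ r t w := by
  intro hr
  have h1 : IsPath r (P ++ [w]) := isPath_append.2 ⟨h.path, ⟨by simp, by simp⟩,
    by simpa using fun hP => h.disj.2.2 hP hw, by simpa [Link, h.last] using hr⟩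
  have := h.longest _ h1 (List.disjoint_append_right.2
    ⟨h.disj.1, by simpa using fun hC => h.disj.2.1 hC hw⟩)
  simp at this

theorem outN_eq' (h : Config r C P Q s t) (v : α) :
    outN r v = cnt (r v) C + cnt (r v) P + cnt (r v) Q := by
  simpa [add_assoc] using outN_eq (r := r) h.nodup h.mem v

theorem inN_eq' (h : Config r C P Q s t) (v : α) :
    inN r v = cnt (fun u => r u v) C + cnt (fun u => r u v) P + cnt (fun u => r u v) Q := by
  simpa [add_assoc] using inN_eq (r := r) h.nodup h.mem v

theorem inN_s (h : Config r C P Q s t) :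
    inN r s = cnt (fun u => r u s) C + cnt (fun u => r u s) P := by
  rw [h.inN_eq', cnt_eq_zero (l := Q) fun w hw => h.not_to_s hw, add_zero]

theorem outN_t (h : Config r C P Q s t) : outN r t = cnt (r t) C + cnt (r t) P := by
  rw [h.outN_eq', cnt_eq_zero (l := Q) fun w hw => h.not_from_t hw, add_zero]

/-- If `s` has no in-neighbour on `C`, then every vertex of `C` has an out-neighbour on `P`. -/
theorem exists_out (h : Config r C P Q s t) (hdeg : DegSum r (Nat.card α + 1))
    (hA : ∀ c ∈ C, ¬ r c s) {c : α} (hc : c ∈ C) : ∃ p ∈ P, r c p := by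
  have h1 := hdeg c s (hA c hc)
  rw [h.inN_s, h.outN_eq', cnt_eq_zero hA, h.card_eq] at h1
  apply exists_of_cnt_pos
  have := cnt_le_length (r c) C
  have := cnt_le_length (r c) Q
  have := cnt_le_length (fun u => r u s) P
  omega

theorem exists_in (h : Config r C P Q s t) (hdeg : DegSum r (Nat.card α + 1))
    (hB : ∀ c ∈ C, ¬ r t c) {c : α} (hc : c ∈ C) : ∃ p ∈ P, r p c := by
  have h1 := hdeg t c (hB c hc)
  rw [h.outN_t, h.inN_eq', cnt_eq_zero hB, h.card_eq] at h1
  apply exists_of_cnt_pos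
  have := cnt_le_length (fun u => r u c) C
  have := cnt_le_length (fun u => r u c) Q
  have := cnt_le_length (r t) P
  omega

theorem not_out_of_not_in (h : Config r C P Q s t) (hdeg : DegSum r (Nat.card α + 1))
    (hA : ∀ c ∈ C, ¬ r c s) : ∀ c ∈ C, ¬ r t c := by
  intro b hb hr
  obtain ⟨l, hl, hp⟩ := h.cyc.exists_cons hb
  obtain ⟨a, ha⟩ : ∃ a, (b :: l).getLast? = some a := by
    rw [List.getLast?_cons]; exact ⟨_, rfl⟩
  obtain ⟨p, hpP, hap⟩ := h.exists_out hdeg hA (hp.mem_iff.1 (List.mem_of_mem_getLast? ha))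
  obtain ⟨P₁, P₂, hP⟩ := List.append_of_mem hpP
  have hpath := h.path
  have hlast := h.last
  have hd := h.disj.1
  rw [hP] at hpath hlast hd
  rw [List.getLast?_append_of_ne_nil _ (by simp)] at hlast
  have hcyc : IsCycle r ((b :: l) ++ (p :: P₂)) := by
    refine isCycle_of_paths hl.toIsPath (isPath_append.1 hpath).2.1 (by simp) (by simp) ?_ ?_ ?_
    · intro x hx
      exact (List.disjoint_append_right.1 hd).2 (hp.mem_iff.1 hx)
    · simpa [Link, ha] using hap
    · simpa [Link, hlast] using hr
  have := h.max _ hcyc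
  rw [List.length_append, hp.length_eq] at this
  simp at this

theorem not_in_of_not_out (h : Config r C P Q s t) (hdeg : DegSum r (Nat.card α + 1))
    (hB : ∀ c ∈ C, ¬ r t c) : ∀ c ∈ C, ¬ r c s := by
  intro a ha hr
  obtain ⟨l, hl, hp⟩ := h.cyc.exists_concat ha
  obtain ⟨b, hb⟩ : ∃ b, (l ++ [a]).head? = some b := by cases l <;> simp
  obtain ⟨p, hpP, hpb⟩ := h.exists_in hdeg hB (hp.mem_iff.1 (List.mem_of_mem_head? hb))
  obtain ⟨P₁, P₂, hP⟩ := List.append_of_mem hpP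
  have e : P₁ ++ p :: P₂ = (P₁ ++ [p]) ++ P₂ := by simp
  have hpath := h.path
  have hhead := h.head
  have hd := h.disj.1
  rw [hP, e] at hpath hhead hd
  rw [List.head?_append_of_ne_nil _ (by simp)] at hhead
  have hcyc : IsCycle r ((l ++ [a]) ++ (P₁ ++ [p])) := by
    refine isCycle_of_paths hl.toIsPath (isPath_append.1 hpath).1 (by simp) (by simp) ?_ ?_ ?_
    · intro x hx
      exact (List.disjoint_append_right.1 hd).1 (hp.mem_iff.1 hx)
    · simp [Link, hhead, hr]
    · simp [Link, hb, hpb]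
  have := h.max _ hcyc
  rw [List.length_append, hp.length_eq] at this
  simp at this

/-- The in-neighbours of `s` on `P` are among the first `|C|` vertices of `P`, as each of them
closes an initial segment of `P` to a cycle. -/
theorem cnt_in_s_le (h : Config r C P Q s t) : cnt (fun u => r u s) P ≤ C.length := by
  by_cases h0 : ∃ u ∈ P, r u s
  · have key : ∀ n : ℕ, ∀ P₁ P₂ : List α, P₂.length = n → P = P₁ ++ P₂ →
        cnt (fun u => r u s) P₂ = 0 → cnt (fun u => r u s) P₁ ≤ C.length := by
      intro n P₁
      induction P₁ using List.reverseRecOn generalizing n with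
      | nil => simp
      | append_singleton P₁ u ih =>
        intro P₂ hn hP h2
        by_cases hu : r u s
        · have hpath := h.path
          have hhead := h.head
          rw [hP] at hpath hhead
          rw [List.head?_append_of_ne_nil _ (by simp)] at hhead
          refine (cnt_le_length _ _).trans (h.max _ ⟨(isPath_append.1 hpath).1, ?_⟩)
          simp [hhead, hu]
        · have := ih _ (u :: P₂) rfl (by simpa using hP) (by simp [cnt_cons, h2, hu])
          simpa [cnt_cons, hu] using this
    exact key _ P [] rfl (by simp) (by simp)
  · push Not at h0
    rw [cnt_eq_zero h0]
    exact Nat.zero_le _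

theorem cyclic_of_not_in (h : Config r C P Q s t) (hdeg : DegSum r (Nat.card α + 1))
    (hA : ∀ c ∈ C, ¬ r c s) : r t s := by
  by_contra hts
  have h1 := hdeg t s hts
  rw [h.inN_s, h.outN_t, cnt_eq_zero hA, cnt_eq_zero (h.not_out_of_not_in hdeg hA),
    h.card_eq] at h1
  have := h.cnt_in_s_le
  have := cnt_le_length (r t) P
  omega

theorem cyclic_of_in (h : Config r C P Q s t) (hdeg : DegSum r (Nat.card α + 1))
    (hA : ∃ c ∈ C, r c s) (hB : ∃ c ∈ C, r t c) : r t s := by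
  by_contra hts
  have h1 := hdeg t s hts
  rw [h.inN_s, h.outN_t, h.card_eq] at h1
  have := cnt_add_cnt_add_length_le h.cyc h.max h.path h.disj.1 h.head h.last hA hB
  have := cnt_lt_length (p := r t) h.s_mem hts
  have := cnt_lt_length (p := fun u => r u s) h.t_mem hts
  omega

/-- If the ends of `P` are joined to `C`, then `P` covers all vertices outside `C`. -/
theorem rest_eq_nil (h : Config r C P Q s t) (hdeg : DegSum r (Nat.card α + 1))
    (hA : ∃ c ∈ C, r c s) (hB : ∃ c ∈ C, r t c) : Q = [] := by
  by_contra hQ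
  obtain ⟨w, hw⟩ := List.exists_mem_of_ne_nil Q hQ
  have h1 := hdeg w s (h.not_to_s hw)
  have h2 := hdeg t w (h.not_from_t hw)
  rw [h.inN_s, h.outN_eq'] at h1
  rw [h.outN_t, h.inN_eq'] at h2
  have h3 := cnt_add_cnt_add_length_le h.cyc h.max h.path h.disj.1 h.head h.last hA hB
  have hwC : C.Disjoint [w] := by simpa using fun hC => h.disj.2.1 hC hw
  have hwP : P.Disjoint [w] := by simpa using fun hP => h.disj.2.2 hP hw
  have h4 : cnt (fun c => r c w) C + cnt (r w) C ≤ C.length := by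
    by_cases hA' : ∃ c ∈ C, r c w
    · by_cases hB' : ∃ c ∈ C, r w c
      · have := cnt_add_cnt_add_length_le h.cyc h.max (P := [w]) ⟨by simp, by simp⟩ hwC
          rfl rfl hA' hB'
        simpa using this
      · push Not at hB'
        rw [cnt_eq_zero hB', add_zero]
        exact cnt_le_length _ _
    · push Not at hA'
      rw [cnt_eq_zero hA', zero_add]
      exact cnt_le_length _ _
  classical
  have h5 : cnt (fun c => r c w) P + cnt (r w) P + 1 ≤ P.length := by
    have hch := isChain_of_not_insert (W := P) (Q := [w]) (r := r) h.path ⟨by simp, by simp⟩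
      rfl rfl hwP (by
        intro P' hP' _ _ hp
        have := h.longest P' hP' fun x hx hxP => by
          rcases List.mem_append.1 (hp.mem_iff.1 hxP) with h' | h'
          · exact h.disj.1 hx h'
          · exact hwC hx h'
        rw [hp.length_eq] at this
        simp at this)
    have := cnt_add_cnt_succ_le hch h.head h.last
    simpa [h.not_to_s hw, h.not_from_t hw] using this
  have h6 := cnt_le_length (r w) Q
  have h7 := cnt_le_length (fun u => r u w) Q
  have h8 := cnt_le_length (r t) P
  have h9 := cnt_le_length (fun u => r u s) P
  have h10 := h.card_eq
  omega

end Config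

theorem exists_rest (l : List α) [Finite α] (hl : l.Nodup) :
    ∃ Q : List α, (l ++ Q).Nodup ∧ ∀ v, v ∈ l ++ Q := by
  classical
  have := Fintype.ofFinite α
  refine ⟨(Finset.univ \ l.toFinset).toList, ?_, ?_⟩
  · rw [List.nodup_append']
    refine ⟨hl, Finset.nodup_toList _, ?_⟩
    intro x hx hx'
    simp at hx'
    exact hx' hx
  · intro v
    simp [em]

theorem IsPath.length_le [Finite α] {l : List α} (h : IsPath r l) : l.length ≤ Nat.card α := by
  obtain ⟨Q, h1, h2⟩ := exists_rest l h.nodup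
  rw [card_eq_length h1 h2]
  simp

/-- If there is no Hamilton cycle, then the vertices outside a suitable longest cycle `C` form a
cycle `P`, and there are arcs in both directions between `C` and `P`. -/
theorem exists_cycle_pair [Finite α] (hdeg : DegSum r (Nat.card α + 1))
    (hnh : ∀ l, IsCycle r l → ∃ v, v ∉ l) :
    ∃ C P : List α, IsCycle r C ∧ (∀ l, IsCycle r l → l.length ≤ C.length) ∧ IsCycle r P ∧
      (C ++ P).Nodup ∧ (∀ v, v ∈ C ++ P) ∧
      (∃ c ∈ C, ∃ s ∈ P, r c s) ∧ (∃ c ∈ C, ∃ t ∈ P, r t c) := by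
  obtain ⟨C, hC, hmax⟩ := exists_longest (p := IsCycle r) (Nat.card α)
    (fun l hl => hl.toIsPath.length_le) ⟨[], ⟨by simp, by simp⟩, by simp [Link]⟩
  obtain ⟨v, hv⟩ := hnh C hC
  obtain ⟨P, ⟨hP, hd⟩, hlong⟩ := exists_longest (p := fun l => IsPath r l ∧ C.Disjoint l)
    (Nat.card α) (fun l hl => hl.1.length_le) ⟨[], ⟨by simp, by simp⟩, by simp⟩
  have hP' : P ≠ [] := by
    rintro rfl
    have := hlong [v] ⟨⟨by simp, by simp⟩, by simpa using hv⟩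
    simp at this
  -- it suffices to find a longest path outside `C` whose ends are joined to `C`
  have fin : ∀ P Q s t, Config r C P Q s t → (∃ c ∈ C, r c s) → ∃ C P : List α, IsCycle r C ∧
      (∀ l, IsCycle r l → l.length ≤ C.length) ∧ IsCycle r P ∧
      (C ++ P).Nodup ∧ (∀ v, v ∈ C ++ P) ∧
      (∃ c ∈ C, ∃ s ∈ P, r c s) ∧ (∃ c ∈ C, ∃ t ∈ P, r t c) := by
    intro P Q s t h hA
    have hB : ∃ c ∈ C, r t c := by
      by_contra hB
      push Not at hB
      obtain ⟨c, hc, hr⟩ := hA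
      exact h.not_in_of_not_out hdeg hB c hc hr
    have hQ := h.rest_eq_nil hdeg hA hB
    have hts := h.cyclic_of_in hdeg hA hB
    have h1 := h.nodup
    have h2 := h.mem
    rw [hQ, List.append_nil] at h1 h2
    obtain ⟨c, hc, hr⟩ := hA
    obtain ⟨c', hc', hr'⟩ := hB
    exact ⟨C, P, hC, hmax, ⟨h.path, by simpa [Link, h.head, h.last] using hts⟩, h1, h2,
      ⟨c, hc, s, h.s_mem, hr⟩, ⟨c', hc', t, h.t_mem, hr'⟩⟩
  have config : ∀ P, IsPath r P → P ≠ [] → C.Disjoint P →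
      (∀ P', IsPath r P' → C.Disjoint P' → P'.length ≤ P.length) →
      ∃ Q t, Config r C P Q (P.head?.getD v) t := by
    intro P hP hP' hd hl
    obtain ⟨Q, hQ, hQ'⟩ := exists_rest (C ++ P) (List.nodup_append'.2 ⟨hC.nodup, hP.nodup, hd⟩)
    refine ⟨Q, P.getLast hP', hC, hmax, hP, hl, hQ, hQ', ?_, List.getLast?_eq_some_getLast hP'⟩
    cases P with
    | nil => exact absurd rfl hP'
    | cons => simp
  obtain ⟨Q, t, h⟩ := config P hP hP' hd fun P' h1 h2 => hlong P' ⟨h1, h2⟩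
  set s := P.head?.getD v
  by_cases hA : ∃ c ∈ C, r c s
  · exact fin P Q s t h hA
  push Not at hA
  have hts := h.cyclic_of_not_in hdeg hA
  have hPc : IsCycle r P := ⟨hP, by simpa [Link, h.head, h.last] using hts⟩
  have hC' : C ≠ [] := by
    rintro rfl
    have := hmax P hPc
    simp at this
    exact hP' this
  obtain ⟨c, hc⟩ := List.exists_mem_of_ne_nil C hC'
  obtain ⟨p, hp, hcp⟩ := h.exists_out hdeg hA hc
  -- rotate the cycle `P` so that it starts at an out-neighbour of `c`
  obtain ⟨l, hl, hperm⟩ := hPc.exists_cons hp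
  obtain ⟨Q', t', h'⟩ := config (p :: l) hl.toIsPath (by simp)
    (fun x hx hx' => hd hx (hperm.mem_iff.1 hx')) fun P' h1 h2 => by
      rw [hperm.length_eq]
      exact hlong P' ⟨h1, h2⟩
  exact fin _ _ _ _ h' ⟨c, hc, by simpa using hcp⟩

/-- The structure of a relation that satisfies the degree sum condition `n + 1`, loops counted, and
has no Hamilton cycle. The vertices split into paths `W`, `I` and `P`; there are no arcs between `I`
and `P`, all arcs (and loops) inside `I` and inside `P` are present, and all vertices of `I` and `P`
are joined to the ends of `W` so that `W` closes up to a cycle with either of `I` and `P`. Moreover,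
the condition is tight for two vertices that are not joined by an arc in either direction.

The proof takes a longest cycle `C = W ++ I`, with `P` outside, such that `I` is as short as
possible. No vertex outside can be inserted into `W`, and neither can all of `I`, as this would make
room for `P`. The resulting upper bounds for the degrees of `c ∈ I` and `s ∈ P` add up to the lower
bound `2 * n + 2`, so that all of them are attained. -/
theorem exists_blocks [Finite α] (hdeg : DegSum r (Nat.card α + 1))
    (hnh : ∀ l, IsCycle r l → ∃ v, v ∉ l) :
    (∃ c s, ¬ r c s ∧ ¬ r s c ∧
      outN r c + inN r c + (outN r s + inN r s) ≤ 2 * Nat.card α + 2) ∧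
    ∃ W I P : List α, W ≠ [] ∧ I ≠ [] ∧ P ≠ [] ∧ IsPath r W ∧ (W ++ I ++ P).Nodup ∧
      (∀ v, v ∈ W ++ I ++ P) ∧ (∀ c ∈ I, ∀ d ∈ I, r c d) ∧ (∀ s ∈ P, ∀ t ∈ P, r s t) ∧
      (∀ e ∈ W.getLast?, ∀ v ∈ I ++ P, r e v) ∧ (∀ b ∈ W.head?, ∀ v ∈ I ++ P, r v b) ∧
      ∀ c ∈ I, ∀ s ∈ P, ¬ r c s ∧ ¬ r s c := by
  classical
  obtain ⟨C, P, hC, hmax, hP, hnd, hall, ⟨c₁, hc₁, s₁, hs₁, h₁⟩, ⟨c₂, hc₂, s₂, hs₂, h₂⟩⟩ :=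
    exists_cycle_pair hdeg hnh
  obtain ⟨W, I, hWI, hperm, ⟨b, hb, s₃, hs₃, hb'⟩, ⟨e, he, s₄, hs₄, he'⟩, hI⟩ :=
    hC.exists_gap (p := fun c => ∃ s ∈ P, r c s) (q := fun c => ∃ s ∈ P, r s c)
      ⟨c₁, hc₁, s₁, hs₁, h₁⟩ ⟨c₂, hc₂, s₂, hs₂, h₂⟩
  have hW : W ≠ [] := by rintro rfl; simp at hb
  have hWp := (isPath_append.1 hWI.toIsPath).1
  have hWIdisj := (isPath_append.1 hWI.toIsPath).2.2.1
  have hCP : C.Disjoint P := (List.nodup_append'.1 hnd).2.2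
  have hlen := hperm.length_eq
  rw [List.length_append] at hlen
  have hWC : ∀ x ∈ W, x ∈ C := fun x hx => hperm.mem_iff.1 (List.mem_append_left _ hx)
  have hIC : ∀ x ∈ I, x ∈ C := fun x hx => hperm.mem_iff.1 (List.mem_append_right _ hx)
  have hperm' : (W ++ I ++ P).Perm (C ++ P) := hperm.append_right P
  have hnd' : (W ++ I ++ P).Nodup := hperm'.nodup_iff.2 hnd
  have hall' : ∀ v, v ∈ W ++ I ++ P := fun v => hperm'.mem_iff.2 (hall v)
  have hcard : Nat.card α = W.length + I.length + P.length := by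
    simpa [add_assoc] using card_eq_length hnd' hall'
  -- a path in `C` from `b` to `e` closes up with a path through `P` to a cycle
  have hshort : ∀ W', IsPath r W' → (∀ x ∈ W', x ∈ C) → W'.head? = some b →
      W'.getLast? = some e → W'.length + 1 ≤ C.length := by
    intro W' hW' hsub hb1 he1
    obtain ⟨q, hq, hqP, hq1, hq2⟩ := hP.exists_path hs₄ hs₃
    have hq0 : q ≠ [] := by rintro rfl; simp at hq1
    have h0 : W' ≠ [] := by rintro rfl; simp at hb1
    have := hmax _ (isCycle_of_paths hW' hq h0 hq0 (fun x hx hx' => hCP (hsub x hx) (hqP x hx'))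
      (by simpa [Link, he1, hq1] using he') (by simpa [Link, hb1, hq2] using hb'))
    rw [List.length_append] at this
    have := List.length_pos_of_ne_nil hq0
    omega
  have hI0 : I ≠ [] := by
    rintro rfl
    have := hshort W hWp hWC hb he
    simp at hlen
    omega
  -- extend `W` inside `C` as far as possible
  obtain ⟨W', ⟨hW'p, hW'C, hW'W, hb1, he1⟩, hW'max⟩ := exists_longest
    (p := fun l => IsPath r l ∧ (∀ x ∈ l, x ∈ C) ∧ (∀ x ∈ W, x ∈ l) ∧ l.head? = some b ∧
      l.getLast? = some e) (Nat.card α) (fun l hl => hl.1.length_le)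
    ⟨W, hWp, hWC, fun _ h => h, hb, he⟩
  set J := C.filter (fun x => decide (x ∉ W')) with hJ
  have hJnd : (W' ++ J).Nodup := by
    refine List.nodup_append'.2 ⟨hW'p.nodup, hC.nodup.filter _, ?_⟩
    intro x hx hx'
    simp [hJ] at hx'
    exact hx'.2 hx
  have hJperm : (W' ++ J).Perm C := by
    refine (List.perm_ext_iff_of_nodup hJnd hC.nodup).2 fun x => ?_
    simp only [hJ, List.mem_append, List.mem_filter, decide_eq_true_eq]
    exact ⟨fun h => h.elim (hW'C x) (fun h => h.1), fun h => by by_cases hx : x ∈ W' <;> simp_all⟩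
  have hJlen := hJperm.length_eq
  rw [List.length_append] at hJlen
  have hJ0 : J ≠ [] := by
    intro h
    have := hshort W' hW'p hW'C hb1 he1
    simp only [h, List.length_nil] at hJlen
    omega
  obtain ⟨c, hcJ⟩ := List.exists_mem_of_ne_nil J hJ0
  have hcW' : c ∉ W' := by
    simp only [hJ, List.mem_filter, decide_eq_true_eq] at hcJ
    exact hcJ.2
  have hcC : c ∈ C := (List.mem_filter.1 hcJ).1
  have hcI : c ∈ I := by
    rcases List.mem_append.1 (hperm.mem_iff.2 hcC) with h | h
    · exact absurd (hW'W c h) hcW'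
    · exact h
  have hWW' : W.length ≤ W'.length := (hWp.nodup.subperm hW'W).length_le
  have hnon : ∀ c ∈ I, ∀ s ∈ P, ¬ r c s ∧ ¬ r s c := fun c hc s hs =>
    ⟨fun h => (hI c hc).1 ⟨s, hs, h⟩, fun h => (hI c hc).2 ⟨s, hs, h⟩⟩
  -- the vertex `c` cannot be inserted into `W'`
  have hc1 : outN r c + inN r c ≤ W'.length + 1 + 2 * J.length := by
    have hch := isChain_of_not_insert (W := W') (Q := [c]) (s := c) (t := c) (r := r) hW'p
      ⟨by simp, by simp⟩ rfl rfl (by simpa using hcW') (by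
        intro W'' hW'' hh hl hp
        have := hW'max W'' ⟨hW'', fun x hx => by
            rcases List.mem_append.1 (hp.mem_iff.1 hx) with h | h
            · exact hW'C x h
            · rw [List.mem_singleton.1 h]; exact hcC,
          fun x hx => hp.mem_iff.2 (List.mem_append_left _ (hW'W x hx)), hh.trans hb1,
          hl.trans he1⟩
        rw [hp.length_eq] at this
        simp at this)
    have h3 := cnt_add_cnt_le hch
    have hp2 : (W' ++ J ++ P).Perm (C ++ P) := hJperm.append_right P
    rw [outN_eq (hp2.nodup_iff.2 hnd) (fun v => hp2.mem_iff.2 (hall v)),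
      inN_eq (hp2.nodup_iff.2 hnd) (fun v => hp2.mem_iff.2 (hall v))]
    simp only [cnt_append]
    rw [cnt_eq_zero (l := P) fun s hs => (hnon c hcI s hs).1,
      cnt_eq_zero (l := P) fun s hs => (hnon c hcI s hs).2]
    have := cnt_le_length (r c) J
    have := cnt_le_length (fun u => r u c) J
    omega
  have hs1 : ∀ s ∈ P, cnt (r s) W + cnt (fun u => r u s) W + 1 ≤
      W.length + (if r s b then 1 else 0) + (if r e s then 1 else 0) := by
    intro s hs
    have hsC : s ∉ C := fun h => hCP h hs
    have hch := isChain_of_not_insert (W := W) (Q := [s]) (r := r) hWp ⟨by simp, by simp⟩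
      rfl rfl (by simpa using fun h => hsC (hWC s h)) (by
        intro W'' hW'' hh hl hp
        have := hmax _ (hWI.replace_left hW hW'' (by
          intro x hx hxI
          rcases List.mem_append.1 (hp.mem_iff.1 hx) with h | h
          · exact hWIdisj h hxI
          · rw [List.mem_singleton.1 h] at hxI
            exact hsC (hIC s hxI)) hh hl)
        rw [List.length_append, hp.length_eq] at this
        simp at this
        omega)
    have := cnt_add_cnt_succ_le hch hb he
    rw [add_comm (cnt (r s) W)]
    exact this
  have hs2 : ∀ s, s ∈ P → outN r s = cnt (r s) W + cnt (r s) P ∧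
      inN r s = cnt (fun u => r u s) W + cnt (fun u => r u s) P := by
    intro s hs
    rw [outN_eq hnd' hall', inN_eq hnd' hall']
    simp only [cnt_append]
    rw [cnt_eq_zero (l := I) fun c hc => (hnon c hc s hs).2,
      cnt_eq_zero (l := I) fun c hc => (hnon c hc s hs).1]
    simp
  have hcs : ∀ c ∈ I, ∀ s ∈ P,
      2 * Nat.card α + 2 ≤ outN r c + inN r c + (outN r s + inN r s) := by
    intro c hcI s hs
    have := hdeg c s (hnon c hcI s hs).1
    have := hdeg s c (hnon c hcI s hs).2
    omega
  have hs3 : ∀ s ∈ P, outN r s + inN r s ≤ W.length + 1 + 2 * P.length := by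
    intro s hs
    have h2 := hs1 s hs
    obtain ⟨h3, h4⟩ := hs2 s hs
    have h5 := cnt_le_length (r s) P
    have h6 := cnt_le_length (fun u => r u s) P
    split_ifs at h2 <;> omega
  -- hence `W'` is not longer than `W`, and no vertex of `I` can be inserted into `W`
  have hWlen : W'.length = W.length := by
    have := hcs c hcI s₁ hs₁
    have := hs3 s₁ hs₁
    omega
  have hc2 : ∀ d ∈ I, outN r d + inN r d + 1 ≤ W.length + (if r d b then 1 else 0) +
      (if r e d then 1 else 0) + cnt (r d) I + I.length := by
    intro d hd
    have hdW : d ∉ W := fun h => hWIdisj h hd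
    have hch := isChain_of_not_insert (W := W) (Q := [d]) (s := d) (t := d) (r := r) hWp
      ⟨by simp, by simp⟩ rfl rfl (by simpa using hdW) (by
        intro W'' hW'' hh hl hp
        have := hW'max W'' ⟨hW'', fun x hx => by
            rcases List.mem_append.1 (hp.mem_iff.1 hx) with h | h
            · exact hWC x h
            · rw [List.mem_singleton.1 h]; exact hIC d hd,
          fun x hx => hp.mem_iff.2 (List.mem_append_left _ hx), hh.trans hb, hl.trans he⟩
        rw [hp.length_eq] at this
        simp at this
        omega)
    have h3 := cnt_add_cnt_succ_le hch hb he
    rw [outN_eq hnd' hall', inN_eq hnd' hall']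
    simp only [cnt_append]
    rw [cnt_eq_zero (l := P) fun s hs => (hnon d hd s hs).1,
      cnt_eq_zero (l := P) fun s hs => (hnon d hd s hs).2]
    have := cnt_le_length (fun u => r u d) I
    omega
  have hall0 : ∀ d ∈ I, r d b ∧ r e d ∧ ∀ d' ∈ I, r d d' := by
    intro d hd
    have h1 := hcs d hd s₁ hs₁
    have h2 := hc2 d hd
    have h3 := hs3 s₁ hs₁
    have h4 := cnt_le_length (r d) I
    refine ⟨?_, ?_, fun d' hd' => ?_⟩
    · by_contra h
      rw [if_neg h] at h2
      split_ifs at h2 <;> omega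
    · by_contra h
      rw [if_neg h] at h2
      split_ifs at h2 <;> omega
    · by_contra h
      have h5 := cnt_lt_length hd' h
      split_ifs at h2 <;> omega
  have hall1 : ∀ s ∈ P, r s b ∧ r e s ∧ ∀ t ∈ P, r s t := by
    intro s hs
    have h1 := hcs c hcI s hs
    have h2 := hs1 s hs
    obtain ⟨h3, h4⟩ := hs2 s hs
    have h5 := cnt_le_length (r s) P
    have h6 := cnt_le_length (fun u => r u s) P
    refine ⟨?_, ?_, fun t ht => ?_⟩
    · by_contra h
      rw [if_neg h] at h2
      split_ifs at h2 <;> omega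
    · by_contra h
      rw [if_neg h] at h2
      split_ifs at h2 <;> omega
    · by_contra h
      have h7 := cnt_lt_length ht h
      split_ifs at h2 <;> omega
  refine ⟨⟨c, s₁, (hnon c hcI s₁ hs₁).1, (hnon c hcI s₁ hs₁).2, ?_⟩, W, I, P, hW, hI0,
    List.ne_nil_of_mem hs₁, hWp, hnd', hall', fun d hd => (hall0 d hd).2.2,
    fun s hs => (hall1 s hs).2.2, ?_, ?_, hnon⟩
  · have := hs3 s₁ hs₁
    omega
  · intro e' hee v hv
    rw [he] at hee
    obtain rfl := Option.some.inj hee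
    exact (List.mem_append.1 hv).elim (fun h => (hall0 v h).2.1) fun h => (hall1 v h).2.1
  · intro b' hbb v hv
    rw [hb] at hbb
    obtain rfl := Option.some.inj hbb
    exact (List.mem_append.1 hv).elim (fun h => (hall0 v h).1) fun h => (hall1 v h).1

/-- With one more in the degree sum condition there is a Hamilton cycle: this is Woodall's theorem
when the relation has all loops. -/
theorem exists_hamilton_cycle [Finite α] (hdeg : DegSum r (Nat.card α + 2)) :
    ∃ l, IsCycle r l ∧ ∀ v, v ∈ l := by
  by_contra hnh
  push Not at hnh
  obtain ⟨⟨c, s, h₁, h₂, h⟩, -⟩ :=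
    exists_blocks (fun i j hij => (Nat.le_succ _).trans (hdeg i j hij)) hnh
  have := hdeg c s h₁
  have := hdeg s c h₂
  omega

variable {ι V : Type*}

/-! ### Hamilton paths with prescribed ends -/

/-- A relation without loops that satisfies the degree sum condition `n + 1` has a Hamilton path
from `p` to `q` for all `p ≠ q`: identify `p` and `q` to a vertex with the out-neighbours of `p` and
the in-neighbours of `q`, and add all loops. This makes up for the arcs that are lost. -/
theorem exists_hamilton_path [Finite ι] {H : ι → ι → Prop} (hirr : ∀ i, ¬ H i i)
    (hdeg : DegSum H (Nat.card ι + 1)) (hcard : 3 ≤ Nat.card ι) {p q : ι} (hpq : p ≠ q) :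
    ∃ l, IsPath H l ∧ (∀ v, v ∈ l) ∧ l.head? = some p ∧ l.getLast? = some q := by
  classical
  -- the vertex `p` stands for the identified pair
  let R : {v // v ≠ q} → {v // v ≠ q} → Prop := fun u v =>
    u = v ∨ H u (if v.1 = p then q else v.1)
  let p' : {v // v ≠ q} := ⟨p, hpq⟩
  have hcard' : Nat.card {v // v ≠ q} + 1 = Nat.card ι := by
    have h1 : Nat.card {v // v ≠ q} = ({q}ᶜ : Set ι).ncard := rfl
    have h2 := Set.ncard_add_ncard_compl ({q} : Set ι)
    rw [Set.ncard_singleton] at h2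
    omega
  have hout : ∀ u : {v // v ≠ q}, outN H u ≤ outN R u := by
    intro u
    refine Set.ncard_le_ncard_of_injOn
      (fun w => if h : w = q then p' else if w = p then u else ⟨w, h⟩) ?_ ?_
    · intro w hw
      have hw' : H u w := hw
      change R u _
      by_cases h1 : w = q
      · right
        simpa [h1, p'] using h1 ▸ hw'
      · by_cases h2 : w = p
        · left
          simp [h2, hpq]
        · right
          simpa [h1, h2] using hw'
    · intro w hw w' hw' he
      have h1 : H u w := hw
      have h2 : H u w' := hw'
      have h3 : w ≠ u := fun h => hirr _ (h ▸ h1)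
      have h4 : w' ≠ u := fun h => hirr _ (h ▸ h2)
      have hu := u.2
      simp only [p'] at he
      split_ifs at he <;> simp_all [Subtype.ext_iff]
  have hin : ∀ v : {v // v ≠ q}, inN H (if v.1 = p then q else v.1) ≤ inN R v := by
    intro v
    refine Set.ncard_le_ncard_of_injOn (fun w => if h : w = q then v else ⟨w, h⟩) ?_ ?_
    · intro w hw
      have hw' : H w (if v.1 = p then q else v.1) := hw
      change R _ v
      by_cases h1 : w = q
      · left
        simp [h1]
      · right
        simpa [h1] using hw'
    · intro w hw w' hw' he
      have h1 : H w (if v.1 = p then q else v.1) := hw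
      have h2 : H w' (if v.1 = p then q else v.1) := hw'
      have h3 : w ≠ (if v.1 = p then q else v.1) := fun h => hirr _ (h ▸ h1)
      have h4 : w' ≠ (if v.1 = p then q else v.1) := fun h => hirr _ (h ▸ h2)
      have hv := v.2
      by_cases h5 : v.1 = p
      · rw [if_pos h5] at h3 h4
        simpa [h3, h4] using he
      · rw [if_neg h5] at h3 h4
        simp only at he
        split_ifs at he <;> simp_all [Subtype.ext_iff]
  obtain ⟨l, hl, hall⟩ := exists_hamilton_cycle (r := R) (by
    intro u v huv
    have h1 : ¬ H u (if v.1 = p then q else v.1) := fun h => huv (Or.inr h)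
    have := hdeg _ _ h1
    have := hout u
    have := hin v
    omega)
  obtain ⟨l', hl', hperm⟩ := hl.exists_cons (hall p')
  have hall' : ∀ v, v ∈ p' :: l' := fun v => hperm.mem_iff.2 (hall v)
  have hlen := card_eq_length hl'.nodup hall'
  rw [List.length_cons] at hlen
  have hp' : p' ∉ l' := (List.nodup_cons.1 hl'.nodup).1
  obtain ⟨e, he⟩ : ∃ e, l'.getLast? = some e := by
    cases h : l'.getLast? with
    | none =>
      rw [List.getLast?_eq_none_iff] at h
      rw [h, List.length_nil] at hlen
      omega
    | some e => exact ⟨e, rfl⟩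
  have hel : e ∈ l' := List.mem_of_mem_getLast? he
  have hlast : (p' :: l').getLast? = some e := by simp [List.getLast?_cons, he]
  refine ⟨(p' :: l').map Subtype.val ++ [q], ?_, ?_, by simp [p'], List.getLast?_concat⟩
  · refine isPath_append.2 ⟨⟨hl'.nodup.map Subtype.val_injective, ?_⟩, ⟨by simp, by simp⟩, ?_, ?_⟩
    · rw [List.isChain_map, List.isChain_iff_forall_rel_of_append_cons_cons]
      intro u v l₁ l₂ h
      have hR : R u v :=
        (List.isChain_iff_forall_rel_of_append_cons_cons.1 hl'.chain) h
      have hnd := hl'.nodup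
      rw [h, List.nodup_append'] at hnd
      have huv : u ≠ v := by
        rintro rfl
        have := hnd.2.1
        simp at this
      have hvp : v.1 ≠ p := by
        intro hv
        have hv' : v = p' := Subtype.ext hv
        cases l₁ with
        | nil =>
          simp only [List.nil_append, List.cons.injEq] at h
          exact huv (h.1.symm.trans hv'.symm)
        | cons x l₁ =>
          simp only [List.cons_append, List.cons.injEq] at h
          exact hp' (by rw [h.2, hv']; simp)
      rcases hR with hR | hR
      · exact absurd hR huv
      · rwa [if_neg hvp] at hR
    · intro x hx hxq
      rw [List.mem_singleton] at hxq
      obtain ⟨y, -, rfl⟩ := List.mem_map.1 hx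
      exact y.2 hxq
    · have := hl'.link e (by rw [hlast]; rfl) p' (by simp)
      rcases this with h | h
      · exact absurd (h ▸ hel) hp'
      · rw [if_pos rfl] at h
        intro x hx y hy
        rw [List.getLast?_map, hlast] at hx
        simp at hx hy
        rw [← hx, ← hy]
        exact h
  · intro v
    by_cases hv : v = q
    · simp [hv]
    · exact List.mem_append_left _ (List.mem_map.2 ⟨⟨v, hv⟩, hall' _, rfl⟩)

/-! ### Matched vertices of a bipartite digraph -/

/-- The vertices of the digraph `D` are the `x i` and the `y i`, all distinct, and the arcs
`y i → x i` form a perfect matching. -/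
structure Matched (D : Digraph V) (x y : ι → V) : Prop where
  inj_x : Function.Injective x
  inj_y : Function.Injective y
  ne : ∀ i j, x i ≠ y j
  cover : ∀ v, ∃ i, v = x i ∨ v = y i
  arc : ∀ i, D.Adj (y i) (x i)

/-- The sequence `y i, x i, y j, x j, …` for a list `i, j, …` of indices. -/
def expand (x y : ι → V) (l : List ι) : List V := l.flatMap fun i => [y i, x i]

namespace Matched

variable {D : Digraph V} {x y : ι → V}

theorem mem_expand {l : List ι} {v : V} : v ∈ expand x y l ↔ ∃ i ∈ l, v = y i ∨ v = x i := by
  simp [expand]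

theorem expand_cons (i : ι) (l : List ι) : expand x y (i :: l) = y i :: x i :: expand x y l := by
  simp [expand]

theorem expand_append (l₁ l₂ : List ι) :
    expand x y (l₁ ++ l₂) = expand x y l₁ ++ expand x y l₂ := by
  simp [expand]

theorem head?_expand (l : List ι) : (expand x y l).head? = l.head?.map y := by
  cases l <;> simp [expand]

theorem getLast?_expand (l : List ι) : (expand x y l).getLast? = l.getLast?.map x := by
  rcases l.eq_nil_or_concat with rfl | ⟨l, i, rfl⟩
  · simp [expand]
  · rw [List.concat_eq_append, expand_append]
    simp [expand]

theorem disjoint_expand (h : Matched D x y) {l₁ l₂ : List ι} (hd : l₁.Disjoint l₂) :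
    (expand x y l₁).Disjoint (expand x y l₂) := by
  intro v hv hv'
  obtain ⟨i, hi, hi'⟩ := mem_expand.1 hv
  obtain ⟨j, hj, hj'⟩ := mem_expand.1 hv'
  have hij : i ≠ j := by rintro rfl; exact hd hi hj
  rcases hi' with rfl | rfl <;> rcases hj' with hj' | hj'
  · exact hij (h.inj_y hj')
  · exact h.ne _ _ hj'.symm
  · exact h.ne _ _ hj'
  · exact hij (h.inj_x hj')

theorem isPath_expand (h : Matched D x y) {l : List ι}
    (hl : IsPath (fun i j => D.Adj (x i) (y j)) l) : IsPath D.Adj (expand x y l) := by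
  induction l with
  | nil => exact ⟨by simp [expand], by simp [expand]⟩
  | cons i l ih =>
    change IsPath _ ([i] ++ l) at hl
    change IsPath _ (expand x y ([i] ++ l))
    rw [isPath_append] at hl
    rw [expand_append, isPath_append]
    refine ⟨⟨?_, ?_⟩, ih hl.2.1, h.disjoint_expand hl.2.2.1, ?_⟩
    · simpa [expand] using (h.ne i i).symm
    · simpa [expand] using h.arc i
    · intro u hu v hv
      rw [head?_expand] at hv
      rw [getLast?_expand] at hu
      obtain ⟨j, hj, rfl⟩ := Option.map_eq_some_iff.1 hv
      obtain ⟨k, hk, rfl⟩ := Option.map_eq_some_iff.1 hu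
      exact hl.2.2.2 k hk j hj

theorem isCycle_expand (h : Matched D x y) {l : List ι}
    (hl : IsCycle (fun i j => D.Adj (x i) (y j)) l) : IsCycle D.Adj (expand x y l) := by
  refine ⟨h.isPath_expand hl.toIsPath, ?_⟩
  intro u hu v hv
  rw [head?_expand] at hv
  rw [getLast?_expand] at hu
  obtain ⟨j, hj, rfl⟩ := Option.map_eq_some_iff.1 hv
  obtain ⟨k, hk, rfl⟩ := Option.map_eq_some_iff.1 hu
  exact hl.link k hk j hj

/-- A cycle through `i` in the contracted relation gives a path from `x i` round to `y i`. -/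
theorem isPath_round (h : Matched D x y) {i : ι} {l : List ι}
    (hl : IsCycle (fun i j => D.Adj (x i) (y j)) (i :: l)) :
    IsPath D.Adj ((x i :: expand x y l) ++ [y i]) := by
  have := h.isCycle_expand hl
  rw [expand_cons] at this
  exact (IsCycle.rotate (l₁ := [y i]) this).toIsPath

theorem hasBypass_of_isPath (h : Matched D x y) {u v : V} {l : List V} (hl : IsPath D.Adj l)
    (hall : ∀ i, x i ∈ l ∧ y i ∈ l) (hu : l.head? = some u) (hv : l.getLast? = some v)
    (huv : u ≠ v) (harc : D.Adj u v) : D.HasHamiltonianBypass := by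
  refine ⟨u, v, l, ⟨hl.nodup, hl.chain, hu, hv⟩, ?_, ?_, harc⟩
  · match l, hu, hv with
    | [w], hu, hv =>
      simp at hu hv
      exact absurd (hu.symm.trans hv) huv
    | _ :: _ :: _, _, _ => simp
  · intro w
    obtain ⟨i, rfl | rfl⟩ := h.cover w
    exacts [(hall i).1, (hall i).2]

/-- A Hamilton path of the contracted relation from `c` to `e`, with the arc `y c → x e`. -/
theorem hasBypass_of_hamilton_path (h : Matched D x y) {l : List ι} {c e : ι}
    (hl : IsPath (fun i j => D.Adj (x i) (y j)) l) (hall : ∀ i, i ∈ l) (hc : l.head? = some c)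
    (he : l.getLast? = some e) (harc : D.Adj (y c) (x e)) : D.HasHamiltonianBypass :=
  h.hasBypass_of_isPath (h.isPath_expand hl)
    (fun i => ⟨mem_expand.2 ⟨i, hall i, Or.inr rfl⟩, mem_expand.2 ⟨i, hall i, Or.inl rfl⟩⟩)
    (by rw [head?_expand, hc]; rfl) (by rw [getLast?_expand, he]; rfl) (h.ne _ _).symm harc

/-- A Hamilton cycle of the contracted relation, with the reverse `x i → y i` of one of its
matching arcs. -/
theorem hasBypass_of_hamilton_cycle (h : Matched D x y) {l : List ι}
    (hl : IsCycle (fun i j => D.Adj (x i) (y j)) l) (hall : ∀ i, i ∈ l) {i : ι}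
    (harc : D.Adj (x i) (y i)) : D.HasHamiltonianBypass := by
  obtain ⟨l', hl', hperm⟩ := hl.exists_cons (hall i)
  refine h.hasBypass_of_isPath (h.isPath_round hl') (fun j => ?_) rfl
    List.getLast?_concat (h.ne _ _) harc
  rcases List.mem_cons.1 (hperm.mem_iff.2 (hall j)) with rfl | hj
  · simp
  · simp only [List.cons_append, List.mem_cons, List.mem_append, mem_expand]
    exact ⟨Or.inr (Or.inl ⟨j, hj, Or.inr rfl⟩), Or.inr (Or.inl ⟨j, hj, Or.inl rfl⟩)⟩

/-- Two disjoint cycles of the contracted relation that cover everything: the path runs from `x i`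
round the first to `y i`, on to `x t`, and round the second to `y t`. -/
theorem hasBypass_of_two_cycles (h : Matched D x y) {i t : ι} {l₁ l₂ : List ι}
    (h₁ : IsCycle (fun i j => D.Adj (x i) (y j)) (i :: l₁))
    (h₂ : IsCycle (fun i j => D.Adj (x i) (y j)) (t :: l₂))
    (hd : (i :: l₁).Disjoint (t :: l₂)) (hall : ∀ j, j ∈ (i :: l₁) ++ (t :: l₂))
    (hit : D.Adj (y i) (x t)) (harc : D.Adj (x i) (y t)) : D.HasHamiltonianBypass := by
  have hsub : ∀ (j : ι) (l : List ι) (v : V), v ∈ (x j :: expand x y l) ++ [y j] ↔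
      v ∈ expand x y (j :: l) := by
    intro j l v
    simp only [expand_cons, List.cons_append, List.mem_cons, List.mem_append, List.not_mem_nil,
      or_false]
    tauto
  refine h.hasBypass_of_isPath (l := ((x i :: expand x y l₁) ++ [y i]) ++
    ((x t :: expand x y l₂) ++ [y t])) (isPath_append.2 ⟨h.isPath_round h₁, h.isPath_round h₂,
    ?_, ?_⟩) (fun j => ?_) rfl ?_ (h.ne _ _) harc
  · intro v hv hv'
    exact h.disjoint_expand hd ((hsub _ _ _).1 hv) ((hsub _ _ _).1 hv')
  · rw [link_concat_left]
    simpa using hit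
  · have hmem : ∀ v, v ∈ expand x y ((i :: l₁) ++ (t :: l₂)) →
        v ∈ ((x i :: expand x y l₁) ++ [y i]) ++ ((x t :: expand x y l₂) ++ [y t]) := by
      intro v hv
      rw [List.mem_append, hsub, hsub, ← List.mem_append, ← expand_append]
      exact hv
    exact ⟨hmem _ (mem_expand.2 ⟨j, hall j, Or.inr rfl⟩),
      hmem _ (mem_expand.2 ⟨j, hall j, Or.inl rfl⟩)⟩
  · rw [List.getLast?_append_of_ne_nil _ (by simp)]
    exact List.getLast?_concat

end Matched

theorem isPath_of_complete {r : ι → ι → Prop} {l : List ι} (hl : l.Nodup)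
    (h : ∀ i ∈ l, ∀ j ∈ l, r i j) : IsPath r l := by
  refine ⟨hl, ?_⟩
  rw [List.isChain_iff_forall_rel_of_append_cons_cons]
  rintro u v l₁ l₂ rfl
  exact h u (by simp) v (by simp)

/-- If there is no bypass, then there is a Hamilton cycle that contains the given matching. -/
theorem Matched.exists_hamilton_cycle [Finite ι] {D : Digraph V} {x y : ι → V}
    (h : Matched D x y) (hH : DegSum (fun i j => D.Adj (x i) (y j)) (Nat.card ι + 1))
    (hG : DegSum (fun i j => D.Adj (y i) (x j)) (Nat.card ι + 1))
    (hno : ¬ D.HasHamiltonianBypass) :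
    ∃ l, IsCycle (fun i j => D.Adj (x i) (y j)) l ∧ ∀ i, i ∈ l := by
  by_contra hnh
  push Not at hnh
  set H : ι → ι → Prop := fun i j => D.Adj (x i) (y j) with hHdef
  set G : ι → ι → Prop := fun i j => D.Adj (y i) (x j) with hGdef
  obtain ⟨-, W, I, P, hW, hI, hP, hWp, hnd, hall, hIc, hPc, hlast, hhead, hnon⟩ :=
    exists_blocks hH hnh
  have hcard : Nat.card ι = W.length + I.length + P.length := by
    simpa [add_assoc] using card_eq_length hnd hall
  have hnd' := hnd
  simp only [List.nodup_append', List.disjoint_append_left] at hnd'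
  obtain ⟨⟨hWnd, hInd, hWI⟩, hPnd, hWP, hIP⟩ := hnd'
  obtain ⟨c, I', rfl⟩ := List.exists_cons_of_ne_nil hI
  obtain ⟨t, P', rfl⟩ := List.exists_cons_of_ne_nil hP
  set I := c :: I' with hIdef
  set P := t :: P' with hPdef
  obtain ⟨d, hd⟩ : ∃ d, I.getLast? = some d := ⟨_, List.getLast?_eq_some_getLast hI⟩
  have hdI : d ∈ I := List.mem_of_mem_getLast? hd
  have hct : c ∈ I := by simp [hIdef]
  have htP : t ∈ P := by simp [hPdef]
  have hPperm : ∀ s ∈ P, ∃ l, (l ++ [s]).Perm P := fun s hs => by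
    obtain ⟨l₁, l₂, he⟩ := List.append_of_mem hs
    refine ⟨l₁ ++ l₂, ?_⟩
    rw [he, List.append_assoc]
    exact List.Perm.append_left _ List.perm_append_comm
  have hIperm : ∀ i ∈ I, ∃ l, (i :: l).Perm I := fun i hi => by
    obtain ⟨l₁, l₂, he⟩ := List.append_of_mem hi
    refine ⟨l₁ ++ l₂, ?_⟩
    rw [he]
    exact List.perm_middle.symm
  -- chord `y i → x s` of the path through `I` from `i`, then `W`, then `P` to `s`
  have hIP' : ∀ i ∈ I, ∀ s ∈ P, ¬ G i s := by
    intro i hi s hs hG'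
    obtain ⟨l₁, hl₁⟩ := hIperm i hi
    obtain ⟨l₂, hl₂⟩ := hPperm s hs
    refine hno (h.hasBypass_of_hamilton_path (l := (i :: l₁) ++ (W ++ (l₂ ++ [s]))) (c := i)
      (e := s) (isPath_append.2 ⟨?_, isPath_append.2 ⟨hWp, ?_, ?_, ?_⟩, ?_, ?_⟩) ?_ rfl ?_ hG')
    · exact isPath_of_complete (hl₁.nodup_iff.2 hInd)
        fun a ha b hb => hIc a (hl₁.mem_iff.1 ha) b (hl₁.mem_iff.1 hb)
    · exact isPath_of_complete (hl₂.nodup_iff.2 hPnd)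
        fun a ha b hb => hPc a (hl₂.mem_iff.1 ha) b (hl₂.mem_iff.1 hb)
    · exact fun a ha hb => hWP ha (hl₂.mem_iff.1 hb)
    · exact fun a ha b hb =>
        hlast a ha b (List.mem_append_right _ (hl₂.mem_iff.1 (List.mem_of_mem_head? hb)))
    · exact List.disjoint_append_right.2 ⟨fun a ha hb => hWI hb (hl₁.mem_iff.1 ha),
        fun a ha hb => hIP (hl₁.mem_iff.1 ha) (hl₂.mem_iff.1 hb)⟩
    · rw [link_append_right hW]
      exact fun a ha b hb =>
        hhead b hb a (List.mem_append_left _ (hl₁.mem_iff.1 (List.mem_of_mem_getLast? ha)))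
    · intro v
      have := hall v
      rw [List.mem_append, List.mem_append] at this
      rw [List.mem_append, List.mem_append, hl₁.mem_iff, hl₂.mem_iff]
      tauto
    · rw [List.getLast?_append_of_ne_nil _ (by simp [hW]),
        List.getLast?_append_of_ne_nil _ (by simp)]
      simp
  have hWI' : IsCycle H (W ++ I) :=
    isCycle_of_paths hWp (isPath_of_complete hInd hIc) hW hI hWI
      (fun a ha b hb => hlast a ha b (List.mem_append_left _ (List.mem_of_mem_head? hb)))
      (fun a ha b hb => hhead b hb a (List.mem_append_left _ (List.mem_of_mem_getLast? ha)))
  -- chord `x i → y t` of the path round `W ++ I` from `x i` to `y i`, then round `P`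
  have hWt : ∀ i ∈ W, ¬ (H i t ∧ G i t) := by
    rintro i hi ⟨h1, h2⟩
    obtain ⟨l, hl, hperm⟩ := hWI'.exists_cons (List.mem_append_left _ hi)
    refine hno (h.hasBypass_of_two_cycles hl (l₂ := P')
      ⟨isPath_of_complete hPnd hPc, fun a ha b hb => hPc a (List.mem_of_mem_getLast? ha) b
        (List.mem_of_mem_head? hb)⟩ ?_ ?_ h2 h1)
    · intro a ha hb
      exact List.disjoint_append_left.2 ⟨hWP, hIP⟩ (hperm.mem_iff.1 ha) hb
    · intro j
      rw [List.mem_append, hperm.mem_iff, ← List.mem_append]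
      exact hall j
  -- chord `y c → x u` of the path through `I` from `c` to `d`, then from `v` to the end of `W`,
  -- then `P`, then from the start of `W` to `u`
  have hWc : W.IsChain (fun u v => ¬ (G c u ∧ H d v)) := by
    rw [List.isChain_iff_forall_rel_of_append_cons_cons]
    rintro u v l₁ l₂ hWe ⟨h1, h2⟩
    have e : l₁ ++ u :: v :: l₂ = (l₁ ++ [u]) ++ v :: l₂ := by simp
    rw [e] at hWe
    have hWp' := hWp
    rw [hWe, isPath_append] at hWp'
    have hl : W.getLast? = (v :: l₂).getLast? := by
      rw [hWe, List.getLast?_append_of_ne_nil _ (by simp)]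
    have hh : W.head? = (l₁ ++ [u]).head? := by
      rw [hWe, List.head?_append_of_ne_nil _ (by simp)]
    have hIP2 : I.Disjoint P := hIP
    rw [hWe, List.disjoint_append_left] at hWI hWP
    refine hno (h.hasBypass_of_hamilton_path (l := I ++ (v :: l₂ ++ (P ++ (l₁ ++ [u])))) (c := c)
      (e := u) (isPath_append.2 ⟨isPath_of_complete hInd hIc, isPath_append.2 ⟨hWp'.2.1,
        isPath_append.2 ⟨isPath_of_complete hPnd hPc, hWp'.1, hWP.1.symm, ?_⟩, ?_, ?_⟩, ?_, ?_⟩)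
      ?_ rfl ?_ h1)
    · exact fun a ha b hb => hhead b (hh ▸ hb) a
        (List.mem_append_right _ (List.mem_of_mem_getLast? ha))
    · exact List.disjoint_append_right.2 ⟨hWP.2, hWp'.2.2.1.symm⟩
    · rw [link_append_right hP]
      exact fun a ha b hb => hlast a (hl ▸ ha) b
        (List.mem_append_right _ (List.mem_of_mem_head? hb))
    · exact List.disjoint_append_right.2 ⟨hWI.2.symm,
        List.disjoint_append_right.2 ⟨hIP2, hWI.1.symm⟩⟩
    · simpa [Link, hd] using h2
    · intro w
      have := hall w
      rw [hWe] at this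
      simp only [List.mem_append] at this ⊢
      tauto
    · rw [List.getLast?_append_of_ne_nil _ (by simp), List.getLast?_append_of_ne_nil _ (by simp),
        List.getLast?_append_of_ne_nil _ (by simp)]
      simp
  have h1 := hG c t (hIP' c hct t htP)
  have h2 := hH d t (hnon d hdI t htP).1
  have h3 := cnt_add_cnt_le hWc
  have h4 : cnt (fun i => H i t) W + cnt (fun i => G i t) W ≤ W.length := by
    clear h1 h2 h3 hWc
    have : ∀ l : List ι, (∀ i ∈ l, ¬ (H i t ∧ G i t)) →
        cnt (fun i => H i t) l + cnt (fun i => G i t) l ≤ l.length := by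
      intro l
      induction l with
      | nil => simp
      | cons i l ih =>
        intro hl
        have h1 := ih fun j hj => hl j (List.mem_cons_of_mem _ hj)
        have h2 := hl i (by simp)
        rw [cnt_cons, cnt_cons, List.length_cons]
        split_ifs with h3 h4 <;> first | omega | exact absurd ⟨h3, h4⟩ h2
    exact this W hWt
  change _ ≤ outN G c + inN G t at h1
  change _ ≤ outN H d + inN H t at h2
  rw [outN_eq hnd hall, inN_eq hnd hall] at h1 h2
  simp only [cnt_append] at h1 h2
  rw [cnt_eq_zero (l := P) fun s hs => hIP' c hct s hs,
    cnt_eq_zero (l := I) fun i hi => hIP' i hi t htP] at h1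
  rw [cnt_eq_zero (l := P) fun s hs => (hnon d hdI s hs).1,
    cnt_eq_zero (l := I) fun i hi => (hnon i hi t htP).1] at h2
  have h5 := cnt_le_length (G c) I
  have h6 := cnt_le_length (H d) I
  have h7 := cnt_le_length (fun i => G i t) P
  have h8 := cnt_le_length (fun i => H i t) P
  omega

/-- The degree sum condition in both directions gives a bypass. By `Matched.exists_hamilton_cycle`
there is a Hamilton cycle that contains the matching. Then no matching arc has a reverse, so that
the contracted relation has no loops, and it has Hamilton paths with any prescribed ends. -/
theorem Matched.hasBypass [Finite ι] {D : Digraph V} {x y : ι → V}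
    (h : Matched D x y) (hH : DegSum (fun i j => D.Adj (x i) (y j)) (Nat.card ι + 1))
    (hG : DegSum (fun i j => D.Adj (y i) (x j)) (Nat.card ι + 1)) (hcard : 3 ≤ Nat.card ι) :
    D.HasHamiltonianBypass := by
  by_contra hno
  obtain ⟨l, hl, hall⟩ := h.exists_hamilton_cycle hH hG hno
  have hirr : ∀ i, ¬ D.Adj (x i) (y i) := fun i hi =>
    hno (h.hasBypass_of_hamilton_cycle hl hall hi)
  obtain ⟨p, q, hpq, harc⟩ : ∃ p q, p ≠ q ∧ D.Adj (y p) (x q) := by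
    by_contra hcon
    push Not at hcon
    have hnt : 1 < Nat.card ι := by omega
    obtain ⟨p, q, hpq⟩ := (Finite.one_lt_card_iff_nontrivial.1 hnt).exists_pair_ne
    have h1 := hG p q (hcon p q hpq)
    have h2 : outN (fun i j => D.Adj (y i) (x j)) p ≤ 1 := by
      rw [← Set.ncard_singleton p]
      refine Set.ncard_le_ncard fun j hj => ?_
      by_contra hne
      exact hcon p j (fun h' => hne h'.symm) hj
    have h3 : inN (fun i j => D.Adj (y i) (x j)) q ≤ 1 := by
      rw [← Set.ncard_singleton q]
      refine Set.ncard_le_ncard fun j hj => ?_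
      by_contra hne
      exact hcon j q hne hj
    omega
  obtain ⟨l', hl', hall', hp, hq⟩ := exists_hamilton_path hirr hH hcard hpq
  exact hno (h.hasBypass_of_hamilton_path hl' hall' hp hq harc)

/-! ### Balanced bipartite digraphs -/

theorem ncard_comp_eq {ι V : Type*} {f : ι → V} (hf : Function.Injective f) {p : V → Prop}
    (hp : ∀ w, p w → ∃ i, f i = w) : {i | p (f i)}.ncard = {w | p w}.ncard := by
  rw [← Set.ncard_image_of_injective _ hf]
  congr 1
  ext w
  constructor
  · rintro ⟨i, hi, rfl⟩
    exact hi
  · intro hw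
    obtain ⟨i, rfl⟩ := hp w hw
    exact ⟨i, hw, rfl⟩

/-- The arcs from `Y` to `X` contain a perfect matching, by Hall's theorem. -/
theorem exists_matched {V : Type*} [Finite V] {D : Digraph V} {X Y : Set V} {a : ℕ}
    (hB : D.IsBalancedBipartition X Y) (hX : X.ncard = a) (hY : Y.ncard = a)
    (hdeg : D.DegreeSumGE X Y (a + 1)) :
    ∃ x : Y → V, Matched D x Subtype.val ∧ (∀ i, x i ∈ X) ∧ ∀ w ∈ X, ∃ i, x i = w := by
  classical
  have := Fintype.ofFinite V
  have hXY : ∀ v, v ∈ X → v ∉ Y := fun v h h' => Set.disjoint_left.1 hB.isCompl.disjoint h h'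
  obtain ⟨x, hx, hxa⟩ := (Finset.all_card_le_biUnion_card_iff_exists_injective
    (fun i : Y => Finset.univ.filter fun w => D.Adj i w)).1 (by
      intro s
      by_contra! hlt
      set N := s.biUnion fun i : Y => Finset.univ.filter fun w => D.Adj i w
      have hs : (Subtype.val '' (s : Set Y) : Set V).ncard = s.card := by
        rw [Set.ncard_image_of_injective _ Subtype.val_injective, Set.ncard_coe_finset]
      have hsY : (Subtype.val '' (s : Set Y) : Set V) ⊆ Y := by
        rintro _ ⟨i, -, rfl⟩
        exact i.2
      have hsa := Set.ncard_le_ncard hsY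
      obtain ⟨u, hu⟩ : s.Nonempty := Finset.card_pos.1 (by omega)
      obtain ⟨v, hvX, hvN⟩ : ∃ v ∈ X, v ∉ (N : Set V) :=
        Set.exists_mem_notMem_of_ncard_lt_ncard (by rw [Set.ncard_coe_finset]; omega)
      have hnot : ∀ i ∈ s, ¬ D.Adj i v := fun i hi h =>
        hvN (Finset.mem_biUnion.2 ⟨i, hi, by simpa using h⟩)
      have h1 := hdeg u v (Or.inr ⟨u.2, hvX⟩) (hnot u hu)
      have h2 : D.outDeg u ≤ N.card := by
        rw [← Set.ncard_coe_finset]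
        exact Set.ncard_le_ncard fun w hw => Finset.mem_biUnion.2 ⟨u, hu, by simpa using hw⟩
      have h3 : D.inDeg v ≤ (Y \ Subtype.val '' (s : Set Y)).ncard := by
        refine Set.ncard_le_ncard fun w hw => ⟨?_, ?_⟩
        · rcases hB.arc w v hw with h | h
          · exact absurd h.2 (hXY v hvX)
          · exact h.1
        · rintro ⟨i, hi, rfl⟩
          exact hnot i hi hw
      have h4 := Set.ncard_sdiff_add_ncard_of_subset hsY
      omega)
  have hxa' : ∀ i : Y, D.Adj i (x i) := fun i => by simpa using hxa i
  have hxX : ∀ i, x i ∈ X := fun i => by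
    rcases hB.arc _ _ (hxa' i) with h | h
    · exact absurd i.2 (hXY _ h.1)
    · exact h.2
  have hrange : Set.range x = X := by
    refine Set.eq_of_subset_of_ncard_le (by rintro _ ⟨i, rfl⟩; exact hxX i) ?_
    rw [← Set.image_univ, Set.ncard_image_of_injective _ hx, Set.ncard_univ, hX, ← hY]
    rfl
  have hsurj : ∀ w ∈ X, ∃ i, x i = w := fun w hw => by rwa [← hrange] at hw
  refine ⟨x, ⟨hx, Subtype.val_injective, fun i j h => hXY _ (hxX i) (h ▸ j.2), fun v => ?_, hxa'⟩,
    hxX, hsurj⟩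
  rcases hB.isCompl.codisjoint.top_le (Set.mem_univ v) with h | h
  · obtain ⟨i, rfl⟩ := hsurj v h
    exact ⟨i, Or.inl rfl⟩
  · exact ⟨⟨v, h⟩, Or.inr rfl⟩

theorem hasBypass_of_degreeSum {V : Type*} [Fintype V] {D : Digraph V} {X Y : Set V} {a : ℕ}
    (ha : 3 ≤ a) (hcard : Fintype.card V = 2 * a) (hB : D.IsBalancedBipartition X Y)
    (hdeg : D.DegreeSumGE X Y (a + 1)) : D.HasHamiltonianBypass := by
  have hXY : ∀ v, v ∈ X → v ∉ Y := fun v h h' => Set.disjoint_left.1 hB.isCompl.disjoint h h'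
  have hsum := Set.ncard_add_ncard_compl X
  rw [hB.isCompl.compl_eq, ← hB.balanced, Nat.card_eq_fintype_card, hcard] at hsum
  have hX : X.ncard = a := by omega
  have hY : Y.ncard = a := hB.balanced ▸ hX
  obtain ⟨x, hx, hxX, hsurj⟩ := exists_matched hB hX hY hdeg
  have hι : Nat.card Y = a := hY
  have hY' : ∀ u v, u ∈ X → D.Adj u v ∨ D.Adj v u → ∃ j : Y, j.1 = v := by
    rintro u v hu (h | h) <;> rcases hB.arc _ _ h with h' | h'
    exacts [⟨⟨v, h'.2⟩, rfl⟩, absurd h'.1 (hXY u hu), absurd h'.2 (hXY u hu), ⟨⟨v, h'.1⟩, rfl⟩]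
  have hX' : ∀ u v, u ∈ Y → D.Adj u v ∨ D.Adj v u → ∃ i, x i = v := by
    rintro u v hu (h | h) <;> rcases hB.arc _ _ h with h' | h'
    exacts [absurd hu (hXY u h'.1), hsurj v h'.2, hsurj v h'.1, absurd hu (hXY u h'.2)]
  refine hx.hasBypass ?_ ?_ (hι ▸ ha)
  · intro i j hij
    rw [hι]
    refine (hdeg _ _ (Or.inl ⟨hxX i, j.2⟩) hij).trans_eq (congrArg₂ _ ?_ ?_)
    · exact (ncard_comp_eq Subtype.val_injective fun w hw => hY' _ w (hxX i) (Or.inl hw)).symm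
    · exact (ncard_comp_eq hx.inj_x fun w hw => hX' _ w j.2 (Or.inr hw)).symm
  · intro i j hij
    rw [hι]
    refine (hdeg _ _ (Or.inr ⟨i.2, hxX j⟩) hij).trans_eq (congrArg₂ _ ?_ ?_)
    · exact (ncard_comp_eq hx.inj_x fun w hw => hX' _ w i.2 (Or.inl hw)).symm
    · exact (ncard_comp_eq Subtype.val_injective fun w hw => hY' _ w (hxX j) (Or.inr hw)).symm

/-! ### Sharpness -/

/-- The directed cycle of length four with every vertex doubled: the vertices are sorted into four
classes modulo `4`, and the arcs lead from each class to the next. -/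
def blownUpCycle : Digraph (Fin (2 * 4)) where
  Adj u v := v.val % 4 = (u.val + 1) % 4

theorem isCycle_blownUpCycle : IsCycle blownUpCycle.Adj (List.finRange (2 * 4)) := by
  refine ⟨⟨by decide, ?_⟩, ?_⟩
  · change List.IsChain (fun u v : Fin (2 * 4) => v.val % 4 = (u.val + 1) % 4) _
    decide
  · change ∀ u ∈ some (7 : Fin (2 * 4)), ∀ v ∈ some (0 : Fin (2 * 4)), v.val % 4 = (u.val + 1) % 4
    decide

theorem outDeg_blownUpCycle (u : Fin (2 * 4)) : blownUpCycle.outDeg u = 2 := by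
  have h : ∀ u : Fin (2 * 4),
      (Finset.univ.filter fun v : Fin (2 * 4) => v.val % 4 = (u.val + 1) % 4).card = 2 := by decide
  refine Eq.trans ?_ (h u)
  rw [← Set.ncard_coe_finset, Finset.coe_filter_univ]
  rfl

theorem inDeg_blownUpCycle (v : Fin (2 * 4)) : blownUpCycle.inDeg v = 2 := by
  have h : ∀ v : Fin (2 * 4),
      (Finset.univ.filter fun u : Fin (2 * 4) => v.val % 4 = (u.val + 1) % 4).card = 2 := by decide
  refine Eq.trans ?_ (h v)
  rw [← Set.ncard_coe_finset, Finset.coe_filter_univ]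
  rfl

theorem mod_of_isChain_blownUpCycle {u v : Fin (2 * 4)} {l : List (Fin (2 * 4))}
    (h : (u :: l).IsChain blownUpCycle.Adj) (hv : (u :: l).getLast? = some v) :
    v.val % 4 = (u.val + l.length) % 4 := by
  induction l generalizing u with
  | nil =>
    obtain rfl : u = v := by simpa using hv
    simp
  | cons w l ih =>
    rw [List.isChain_cons_cons] at h
    have h1 : w.val % 4 = (u.val + 1) % 4 := h.1
    have h2 := ih h.2 (by rwa [List.getLast?_cons_cons] at hv)
    rw [List.length_cons]
    omega

/-- A path through all eight vertices ends seven classes after the class of its first vertex, that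
is, in the class before, and no arc leads there. -/
theorem not_hasBypass_blownUpCycle : ¬ blownUpCycle.HasHamiltonianBypass := by
  rintro ⟨u, v, l, ⟨hnd, hch, hu, hv⟩, -, hall, harc⟩
  have hlen := card_eq_length hnd hall
  rw [Nat.card_eq_fintype_card, Fintype.card_fin] at hlen
  cases l with
  | nil => simp at hu
  | cons w l =>
    obtain rfl : w = u := by simpa using hu
    have h1 := mod_of_isChain_blownUpCycle hch hv
    have h2 : v.val % 4 = (w.val + 1) % 4 := harc
    rw [List.length_cons] at hlen
    omega

theorem isBalancedBipartition_blownUpCycle :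
    blownUpCycle.IsBalancedBipartition {v | v.val % 2 = 0} {v | ¬ v.val % 2 = 0} := by
  refine ⟨isCompl_compl, ?_, ?_⟩
  · have h : (Finset.univ.filter fun v : Fin (2 * 4) => v.val % 2 = 0).card =
        (Finset.univ.filter fun v : Fin (2 * 4) => ¬ v.val % 2 = 0).card := by decide
    rwa [← Set.ncard_coe_finset, ← Set.ncard_coe_finset, Finset.coe_filter_univ,
      Finset.coe_filter_univ] at h
  · intro u v h
    have h' : v.val % 4 = (u.val + 1) % 4 := h
    simp only [Set.mem_ofPred_eq]
    omega

end HamBypass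

open HamBypass in
/-- The first part is the sufficient condition. The second part is its sharpness: for `a = 4`, the
bound `a + 1` cannot be lowered to `a`, even for Hamiltonian digraphs. -/
theorem theorem1p6 :
    (∀ (V : Type*) [Fintype V] (D : Digraph V) (X Y : Set V) (a : ℕ),
      3 ≤ a → Fintype.card V = 2 * a →
      D.IsBalancedBipartition X Y → D.IsStrong → D.DegreeSumGE X Y (a + 1) →
      D.HasHamiltonianBypass) ∧
    (∃ (D : Digraph (Fin (2 * 4))) (X Y : Set (Fin (2 * 4))),
      D.IsBalancedBipartition X Y ∧ D.IsStrong ∧ D.IsHamiltonianDigraph ∧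
      D.DegreeSumGE X Y 4 ∧ ¬ D.HasHamiltonianBypass) := by
  refine ⟨fun V _ D X Y a ha hcard hB _ hdeg => hasBypass_of_degreeSum ha hcard hB hdeg,
    blownUpCycle, _, _, isBalancedBipartition_blownUpCycle, fun u v _ => ?_, ?_, fun u v _ _ => ?_,
    not_hasBypass_blownUpCycle⟩
  · obtain ⟨l, hl, -, hu, hv⟩ :=
      isCycle_blownUpCycle.exists_path (List.mem_finRange u) (List.mem_finRange v)
    exact ⟨l, hl.nodup, hl.chain, hu, hv⟩
  · have hc := isCycle_blownUpCycle
    exact ⟨0, 7, _, ⟨hc.nodup, hc.chain, rfl, rfl⟩, by simp, List.mem_finRange,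
      hc.link 7 rfl 0 rfl⟩
  · rw [outDeg_blownUpCycle, inDeg_blownUpCycle]
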